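/- Let $d \ge 2$ and $N \ge 2$ be integers and let $(c_1, c_2, c_3, \dots)$ be a nonincreasing sequence of numbers in $[0,1]$. Then there exist a probability space $(\Omega, \mathcal F, P)$ and, on it, a strictly stationary random field $X = (X_k,\ k \in \mathbb Z^d)$ of real random variables with the following properties. (A) The random variable $X_{\mathbf 0}$ is uniformly distributed on $[0,1]$. (B) $X$ is $N$-tuplewise independent: for every choice of $N$ distinct elements $k(1), \dots, k(N) \in \mathbb Z^d$ the random variables $X_{k(1)}, \dots, X_{k(N)}$ are independent. (C) For every integer $n \ge 1$ one has $\rho^*(n) = 1$; also $\rho(1) = \rho'(1) = 1$. (D) For every integer $n \ge 2$ one has $\rho(n) = \rho'(n) = c_n$. Here the dependence coefficients are defined as follows. For $\sigma$-fields $\mathcal A, \mathcal B \subset \mathcal F$ put $\rho(\mathcal A, \mathcal B) := \sup |\mathrm{Corr}(f,g)|$, where the supremum is over all square-integrable real random variables $f$, $g$ such that $f$ is $\mathcal A$-measurable and $g$ is $\mathcal B$-measurable (with $\mathrm{Corr}(f,g) := 0$ if $f$ or $g$ is a.s. constant). For nonempty $S, T \subset \mathbb Z^d$ put $r(S,T)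 := \rho(\sigma(X_k, k \in S), \sigma(X_k, k \in T))$, and let $\mathrm{dist}(S,T)$ be the smallest Euclidean distance between a point of $S$ and a point of $T$ (and similarly for subsets of $\mathbb Z$). For each integer $n \ge 1$: - $\rho(n)$ is the supremum of $r(\{k : k_u \le j\}, \{k : k_u \ge j+n\})$ over all $j \in \mathbb Z$ and $u \in \{1, \dots, d\}$; - $\rho'(n)$ is the supremum of $r(\{k : k_u \in G\}, \{k : k_u \in H\})$ over all $u \in \{1, \dots, d\}$ and all nonempty disjoint $G, H \subset \mathbb Z$ with $\mathrm{dist}(G,H) \ge n$; - $\rho^*(n)$ is the supremum of $r(S,T)$ over all nonempty disjoint $S, T \subset \mathbb Z^d$ with $\mathrm{dist}(S,T) \ge n$. -/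

import Mathlib

open MeasureTheory ProbabilityTheory

/-- The correlation `Cov(f, g) / (√Var f · √Var g)`. If one of the variances vanishes the value is
`0`, the usual convention for constant random variables. -/
noncomputable def corr {Ω : Type*} {mΩ : MeasurableSpace Ω} (f g : Ω → ℝ) (P : Measure Ω) : ℝ :=
  covariance f g P / (√(variance f P) * √(variance g P))

/-- Correlations are bounded by one in absolute value, so that the suprema below are suprema of
nonempty sets bounded by one. -/
theorem abs_corr_le_one {Ω : Type*} {mΩ : MeasurableSpace Ω} {P : Measure Ω}
    [IsProbabilityMeasure P] {f g : Ω → ℝ} (hf : MemLp f 2 P) (hg : MemLp g 2 P) :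
    |corr f g P| ≤ 1 := by
  have key : ∀ t : ℝ, 0 ≤ variance g P * (t * t) + 2 * covariance f g P * t + variance f P := by
    intro t
    have h := variance_nonneg (f + t • g) P
    rw [variance_add hf (hg.const_smul t), covariance_smul_right, variance_smul] at h
    linarith
  have hd := discrim_le_zero key
  have hvf := variance_nonneg f P
  have hvg := variance_nonneg g P
  unfold discrim at hd
  unfold corr
  rw [abs_div, abs_of_nonneg (by positivity : 0 ≤ √(variance f P) * √(variance g P))]
  refine div_le_one_of_le₀ ?_ (by positivity)
  rw [← Real.sqrt_mul hvf]
  apply Real.abs_le_sqrt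
  nlinarith

/-- The absolute values of the correlations of all pairs of square-integrable random variables
`f`, `g` with `f` measurable for `𝒜` and `g` measurable for `ℬ`. -/
def corrSet {Ω : Type*} (𝒜 ℬ : MeasurableSpace Ω) {mΩ : MeasurableSpace Ω} (P : Measure Ω) :
    Set ℝ :=
  {r | ∃ f g : Ω → ℝ, Measurable[𝒜] f ∧ Measurable[ℬ] g ∧ MemLp f 2 P ∧ MemLp g 2 P ∧
    r = |corr f g P|}

theorem corrSet_nonempty {Ω : Type*} (𝒜 ℬ : MeasurableSpace Ω) {mΩ : MeasurableSpace Ω}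
    (P : Measure Ω) : (corrSet 𝒜 ℬ P).Nonempty :=
  ⟨_, 0, 0, measurable_const, measurable_const, MemLp.zero, MemLp.zero, rfl⟩

theorem corrSet_bddAbove {Ω : Type*} (𝒜 ℬ : MeasurableSpace Ω) {mΩ : MeasurableSpace Ω}
    (P : Measure Ω) [IsProbabilityMeasure P] : BddAbove (corrSet 𝒜 ℬ P) := by
  refine ⟨1, ?_⟩
  rintro r ⟨f, g, -, -, hf, hg, rfl⟩
  exact abs_corr_le_one hf hg

/-- The maximal correlation coefficient `ρ(𝒜, ℬ)` of two σ-fields. -/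
noncomputable def maxCorr {Ω : Type*} (𝒜 ℬ : MeasurableSpace Ω) {mΩ : MeasurableSpace Ω}
    (P : Measure Ω) : ℝ :=
  sSup (corrSet 𝒜 ℬ P)

/-- The σ-field `σ(X_k, k ∈ S)` generated by the random variables with index in `S`. -/
abbrev sigmaField {Ω ι : Type*} (X : ι → Ω → ℝ) (S : Set ι) : MeasurableSpace Ω :=
  ⨆ k ∈ S, MeasurableSpace.comap (X k) (inferInstance : MeasurableSpace ℝ)

/-- `ρ(σ(X_k, k ∈ S), σ(X_k, k ∈ T))`. -/
noncomputable def fieldCorr {Ω ι : Type*} {mΩ : MeasurableSpace Ω} (P : Measure Ω)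
    (X : ι → Ω → ℝ) (S T : Set ι) : ℝ :=
  maxCorr (sigmaField X S) (sigmaField X T) P

/-- The Euclidean norm on `ℤ^d`. -/
noncomputable def latticeNorm {d : ℕ} (k : Fin d → ℤ) : ℝ :=
  √(∑ u, (k u : ℝ) ^ 2)

/-- The distance of two (nonempty) subsets of `ℤ^d` with respect to the Euclidean norm. -/
noncomputable def latticeDist {d : ℕ} (S T : Set (Fin d → ℤ)) : ℝ :=
  sInf {r | ∃ s ∈ S, ∃ t ∈ T, r = latticeNorm (s - t)}

/-- The distance of two (nonempty) subsets of `ℤ`. -/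
noncomputable def intDist (G H : Set ℤ) : ℝ :=
  sInf {r | ∃ g ∈ G, ∃ h ∈ H, r = |(g : ℝ) - (h : ℝ)|}

/-- The coefficient `ρ(X, n)`: opposite half-spaces orthogonal to a coordinate axis. -/
noncomputable def rho {Ω : Type*} {mΩ : MeasurableSpace Ω} {d : ℕ} (P : Measure Ω)
    (X : (Fin d → ℤ) → Ω → ℝ) (n : ℕ) : ℝ :=
  sSup {r | ∃ (j : ℤ) (u : Fin d), r = fieldCorr P X {k | k u ≤ j} {k | j + n ≤ k u}}

/-- The coefficient `ρ'(X, n)`: possibly interlaced unions of slices orthogonal to a coordinate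
axis. -/
noncomputable def rhoPrime {Ω : Type*} {mΩ : MeasurableSpace Ω} {d : ℕ} (P : Measure Ω)
    (X : (Fin d → ℤ) → Ω → ℝ) (n : ℕ) : ℝ :=
  sSup {r | ∃ (u : Fin d) (G H : Set ℤ), G.Nonempty ∧ H.Nonempty ∧ Disjoint G H ∧
    (n : ℝ) ≤ intDist G H ∧ r = fieldCorr P X {k | k u ∈ G} {k | k u ∈ H}}

/-- The coefficient `ρ*(X, n)`: arbitrary nonempty disjoint index sets at distance at least `n`. -/
noncomputable def rhoStar {Ω : Type*} {mΩ : MeasurableSpace Ω} {d : ℕ} (P : Measure Ω)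
    (X : (Fin d → ℤ) → Ω → ℝ) (n : ℕ) : ℝ :=
  sSup {r | ∃ S T : Set (Fin d → ℤ), S.Nonempty ∧ T.Nonempty ∧ Disjoint S T ∧
    (n : ℝ) ≤ latticeDist S T ∧ r = fieldCorr P X S T}

/-- Strict stationarity: all the shifted fields `(X_{k+v})_k` have the same law on `ℝ^(ℤ^d)`. -/
def StrictlyStationary {Ω : Type*} {mΩ : MeasurableSpace Ω} {d : ℕ} (P : Measure Ω)
    (X : (Fin d → ℤ) → Ω → ℝ) : Prop :=
  ∀ v : Fin d → ℤ, IdentDistrib (fun ω k => X (k + v) ω) (fun ω k => X k ω) P P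

/-- `N`-tuplewise independence: any `N` of the random variables with pairwise distinct indices
are independent. -/
def TuplewiseIndep {Ω : Type*} {mΩ : MeasurableSpace Ω} {d : ℕ} (N : ℕ) (P : Measure Ω)
    (X : (Fin d → ℤ) → Ω → ℝ) : Prop :=
  ∀ κ : Fin N → (Fin d → ℤ), Function.Injective κ → iIndepFun (fun i => X (κ i)) P

/-!
A *template* is a finite set `F ⊂ ℤ^d` with a parameter `c ∈ [0, 1]`. Its points carry binary digits
whose joint law has density `1 + c · (product of all signs)` with respect to independent fair coins
(`parityMeasure`). Any `|F| - 1` of these digits are independent fair coins. Two disjoint parts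
of `F` are independent unless they exhaust `F`; if they do, their maximal correlation is exactly
`c`, because the density couples only the two full sign products
(`abs_covariance_parityMeasure_le`, `corr_walsh`).

Given countably many templates with more than `N` points each, put an independent copy of every
template at every position of `ℤ^d`, and let `X_k` be the number whose binary digits are all the
digits that the site `k` receives (`field`). The field is stationary by construction. Each `X_k` is
uniform, since fair digits represent a uniform number, and any `N` of the `X_k` are independent,
since `N` sites contain no complete translate of a template. As the digits can be recovered
almost surely from `X_k`, the maximal correlation between disjoint sets of sites `S` and `T` is
controlled by the translates of templates that are contained in `S ∪ T` and meet both: it is at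
least the parameter of each of them (`le_fieldCorr_field`), and it is at most any `b ≥ 0` that
bounds all these parameters (`fieldCorr_field_le`). The upper bound is the Csáki–Fischer inequality:
the maximal correlation of independent pairs of σ-fields is the supremum of the individual ones
(`CorrLe.sup` for two pairs, `CorrLe.iSup_of_iIndep` for a sequence).

It remains to choose the templates. The diagonal of a cube together with a vertex off the diagonal
splits into two distant parts, but its projections to the coordinate axes are intervals. With
parameter `1` and side lengths tending to infinity it yields `ρ*(n) = 1` for all `n` and
`ρ(1) = 1`, and it is invisible to sets of slices at distance at least `2`. Points on a
coordinate axis with constant gaps `m ≥ 2` and parameter `c m` are split by such sets only if their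
distance is at most `m`, so `ρ(n) = ρ'(n) = sup_{m ≥ n} c m = c n` (`templateParam_le`).
-/

open Filter Topology

/-! ### Maximal correlation under dominated and martingale limits -/

theorem tendsto_integral_mul_of_dominated {Ω : Type*} {mΩ : MeasurableSpace Ω} {P : Measure Ω}
    {f g : ℕ → Ω → ℝ} {f' g' F G : Ω → ℝ}
    (hf : ∀ n, AEStronglyMeasurable (f n) P) (hg : ∀ n, AEStronglyMeasurable (g n) P)
    (hF : MemLp F 2 P) (hG : MemLp G 2 P)
    (hfF : ∀ n, ∀ᵐ ω ∂P, |f n ω| ≤ F ω) (hgG : ∀ n, ∀ᵐ ω ∂P, |g n ω| ≤ G ω)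
    (hf' : ∀ᵐ ω ∂P, Tendsto (fun n => f n ω) atTop (𝓝 (f' ω)))
    (hg' : ∀ᵐ ω ∂P, Tendsto (fun n => g n ω) atTop (𝓝 (g' ω))) :
    Tendsto (fun n => ∫ ω, f n ω * g n ω ∂P) atTop (𝓝 (∫ ω, f' ω * g' ω ∂P)) := by
  refine tendsto_integral_of_dominated_convergence (fun ω => F ω * G ω)
    (fun n => (hf n).mul (hg n)) (hF.integrable_mul hG) (fun n => ?_) ?_
  · filter_upwards [hfF n, hgG n] with ω h1 h2
    rw [Real.norm_eq_abs, abs_mul]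
    exact mul_le_mul h1 h2 (abs_nonneg _) ((abs_nonneg _).trans h1)
  · filter_upwards [hf', hg'] with ω h1 h2 using h1.mul h2

theorem tendsto_covariance_of_dominated {Ω : Type*} {mΩ : MeasurableSpace Ω} {P : Measure Ω}
    [IsProbabilityMeasure P] {f g : ℕ → Ω → ℝ} {f' g' F G : Ω → ℝ}
    (hf : ∀ n, AEStronglyMeasurable (f n) P) (hg : ∀ n, AEStronglyMeasurable (g n) P)
    (hF : MemLp F 2 P) (hG : MemLp G 2 P)
    (hfF : ∀ n, ∀ᵐ ω ∂P, |f n ω| ≤ F ω) (hgG : ∀ n, ∀ᵐ ω ∂P, |g n ω| ≤ G ω)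
    (hf' : ∀ᵐ ω ∂P, Tendsto (fun n => f n ω) atTop (𝓝 (f' ω)))
    (hg' : ∀ᵐ ω ∂P, Tendsto (fun n => g n ω) atTop (𝓝 (g' ω)))
    (hf'L : MemLp f' 2 P) (hg'L : MemLp g' 2 P) :
    Tendsto (fun n => covariance (f n) (g n) P) atTop (𝓝 (covariance f' g' P)) := by
  have hfL : ∀ n, MemLp (f n) 2 P := fun n => hF.mono' (hf n) (by simpa using hfF n)
  have hgL : ∀ n, MemLp (g n) 2 P := fun n => hG.mono' (hg n) (by simpa using hgG n)
  rw [covariance_eq_sub hf'L hg'L]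
  simp_rw [fun n => covariance_eq_sub (hfL n) (hgL n)]
  have h1 : MemLp (fun _ : Ω => (1 : ℝ)) 2 P := memLp_const 1
  have e1 := tendsto_integral_mul_of_dominated hf (g := fun _ _ => 1)
    (fun _ => aestronglyMeasurable_const) hF h1 hfF (by simp) hf' (g' := fun _ => 1) (by simp)
  have e2 := tendsto_integral_mul_of_dominated hg (g := fun _ _ => 1)
    (fun _ => aestronglyMeasurable_const) hG h1 hgG (by simp) hg' (g' := fun _ => 1) (by simp)
  simp only [mul_one] at e1 e2
  exact (tendsto_integral_mul_of_dominated hf hg hF hG hfF hgG hf' hg').sub (e1.mul e2)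

/-- The maximal correlation of `𝒜` and `ℬ` is at most `b`, in a form that avoids quotients and
only tests bounded functions. -/
def CorrLe {Ω : Type*} (b : ℝ) (𝒜 ℬ : MeasurableSpace Ω) {mΩ : MeasurableSpace Ω}
    (P : Measure Ω) : Prop :=
  ∀ f g : Ω → ℝ, Measurable[𝒜] f → Measurable[ℬ] g →
    (∃ C, ∀ ω, |f ω| ≤ C) → (∃ C, ∀ ω, |g ω| ≤ C) →
    |covariance f g P| ≤ b * (√(variance f P) * √(variance g P))

theorem memLp_of_abs_le {Ω : Type*} {mΩ : MeasurableSpace Ω} {P : Measure Ω}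
    [IsFiniteMeasure P] {f : Ω → ℝ} (hf : Measurable f) (h : ∃ C, ∀ ω, |f ω| ≤ C) (p : ENNReal) :
    MemLp f p P := by
  obtain ⟨C, hC⟩ := h
  exact MemLp.of_bound hf.aestronglyMeasurable C (ae_of_all _ hC)

/-- An inequality `|Cov| ≤ b √Var √Var` passes to dominated pointwise limits. -/
theorem abs_covariance_le_of_tendsto {Ω : Type*} {mΩ : MeasurableSpace Ω} {P : Measure Ω}
    [IsProbabilityMeasure P] {b : ℝ} {f g : ℕ → Ω → ℝ} {f' g' F G : Ω → ℝ}
    (hf : ∀ n, AEStronglyMeasurable (f n) P) (hg : ∀ n, AEStronglyMeasurable (g n) P)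
    (hF : MemLp F 2 P) (hG : MemLp G 2 P)
    (hfF : ∀ n, ∀ᵐ ω ∂P, |f n ω| ≤ F ω) (hgG : ∀ n, ∀ᵐ ω ∂P, |g n ω| ≤ G ω)
    (hf' : ∀ᵐ ω ∂P, Tendsto (fun n => f n ω) atTop (𝓝 (f' ω)))
    (hg' : ∀ᵐ ω ∂P, Tendsto (fun n => g n ω) atTop (𝓝 (g' ω)))
    (hf'L : MemLp f' 2 P) (hg'L : MemLp g' 2 P)
    (h : ∀ n, |covariance (f n) (g n) P| ≤ b * (√(variance (f n) P) * √(variance (g n) P))) :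
    |covariance f' g' P| ≤ b * (√(variance f' P) * √(variance g' P)) := by
  have e0 := tendsto_covariance_of_dominated hf hg hF hG hfF hgG hf' hg' hf'L hg'L
  have e1 := tendsto_covariance_of_dominated hf hf hF hF hfF hfF hf' hf' hf'L hf'L
  have e2 := tendsto_covariance_of_dominated hg hg hG hG hgG hgG hg' hg' hg'L hg'L
  simp only [covariance_self (hf _).aemeasurable, covariance_self (hg _).aemeasurable,
    covariance_self hf'L.aemeasurable, covariance_self hg'L.aemeasurable] at e1 e2
  exact le_of_tendsto_of_tendsto' e0.abs
    ((((Real.continuous_sqrt.tendsto _).comp e1).mul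
      ((Real.continuous_sqrt.tendsto _).comp e2)).const_mul b) h

theorem tendsto_truncate (x : ℝ) :
    Tendsto (fun n : ℕ => max (-(n : ℝ)) (min n x)) atTop (𝓝 x) := by
  refine tendsto_const_nhds.congr' ?_
  filter_upwards [eventually_ge_atTop ⌈|x|⌉₊] with n hn
  have h := abs_le.1 ((Nat.le_ceil |x|).trans (Nat.cast_le.2 hn))
  rw [min_eq_right h.2, max_eq_right h.1]

/-- By truncation, the bound for bounded functions extends to square-integrable ones. -/
theorem CorrLe.abs_covariance_le {Ω : Type*} {b : ℝ} {𝒜 ℬ mΩ : MeasurableSpace Ω}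
    {P : Measure Ω} [IsProbabilityMeasure P] (h : CorrLe b 𝒜 ℬ P) (hA : 𝒜 ≤ mΩ) (hB : ℬ ≤ mΩ)
    {f g : Ω → ℝ} (hf : Measurable[𝒜] f) (hg : Measurable[ℬ] g)
    (hfL : MemLp f 2 P) (hgL : MemLp g 2 P) :
    |covariance f g P| ≤ b * (√(variance f P) * √(variance g P)) := by
  have trunc_meas : ∀ (m : MeasurableSpace Ω) (u : Ω → ℝ), Measurable[m] u → ∀ n : ℕ,
      Measurable[m] (fun ω => max (-(n : ℝ)) (min (n : ℝ) (u ω))) := fun m u hu n =>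
    measurable_const.max (measurable_const.min hu)
  have trunc_le : ∀ (n : ℕ) (x : ℝ), |max (-(n : ℝ)) (min (n : ℝ) x)| ≤ |x| := fun n x => by
    have hn : (0 : ℝ) ≤ n := n.cast_nonneg
    rw [abs_le]
    constructor
    · rcases le_total x n with h1 | h1
      · rw [min_eq_right h1]; exact (neg_abs_le x).trans (le_max_right _ _)
      · exact (neg_nonpos.2 (abs_nonneg x)).trans
          (le_max_of_le_right (le_min hn (hn.trans h1)))
    · rcases le_total (-(n : ℝ)) (min n x) with h1 | h1
      · rw [max_eq_right h1]; exact (min_le_right _ _).trans (le_abs_self x)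
      · rw [max_eq_left h1]; linarith [abs_nonneg x]
  have trunc_bdd : ∀ (n : ℕ) (x : ℝ), |max (-(n : ℝ)) (min (n : ℝ) x)| ≤ n := fun n x => by
    have hn : (0 : ℝ) ≤ n := n.cast_nonneg
    exact abs_le.2 ⟨le_max_left _ _, max_le (by linarith) (min_le_left _ _)⟩
  refine abs_covariance_le_of_tendsto
    (f := fun n ω => max (-(n : ℝ)) (min (n : ℝ) (f ω)))
    (g := fun n ω => max (-(n : ℝ)) (min (n : ℝ) (g ω)))
    (fun n => ((trunc_meas 𝒜 f hf n).mono hA le_rfl).aestronglyMeasurable)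
    (fun n => ((trunc_meas ℬ g hg n).mono hB le_rfl).aestronglyMeasurable) hfL.abs hgL.abs
    (fun n => ae_of_all _ fun ω => trunc_le n _) (fun n => ae_of_all _ fun ω => trunc_le n _)
    (ae_of_all _ fun ω => tendsto_truncate _) (ae_of_all _ fun ω => tendsto_truncate _) hfL hgL
    (fun n => h _ _ (trunc_meas 𝒜 f hf n) (trunc_meas ℬ g hg n)
      ⟨n, fun ω => trunc_bdd n _⟩ ⟨n, fun ω => trunc_bdd n _⟩)

theorem CorrLe.maxCorr_le {Ω : Type*} {b : ℝ} {𝒜 ℬ mΩ : MeasurableSpace Ω}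
    {P : Measure Ω} [IsProbabilityMeasure P] (h : CorrLe b 𝒜 ℬ P) (hb : 0 ≤ b)
    (hA : 𝒜 ≤ mΩ) (hB : ℬ ≤ mΩ) : maxCorr 𝒜 ℬ P ≤ b := by
  refine csSup_le (corrSet_nonempty _ _ _) ?_
  rintro r ⟨f, g, hf, hg, hfL, hgL, rfl⟩
  rw [corr, abs_div, abs_of_nonneg (by positivity : 0 ≤ √(variance f P) * √(variance g P))]
  exact div_le_of_le_mul₀ (by positivity) hb (h.abs_covariance_le hA hB hf hg hfL hgL)

theorem CorrLe.mono {Ω : Type*} {b : ℝ} {𝒜 ℬ 𝒜' ℬ' : MeasurableSpace Ω} {_ : MeasurableSpace Ω}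
    {P : Measure Ω} (h : CorrLe b 𝒜 ℬ P) (hA : 𝒜' ≤ 𝒜) (hB : ℬ' ≤ ℬ) : CorrLe b 𝒜' ℬ' P :=
  fun f g hf hg => h f g (hf.mono hA le_rfl) (hg.mono hB le_rfl)

/-- By Lévy's upward theorem the bound passes from two filtrations to their limits. -/
theorem CorrLe.iSup_filtration {Ω : Type*} {b : ℝ} {mΩ : MeasurableSpace Ω}
    {P : Measure Ω} [IsProbabilityMeasure P] (𝒜 ℬ : Filtration ℕ mΩ)
    (h : ∀ n, CorrLe b (𝒜 n) (ℬ n) P) : CorrLe b (⨆ n, 𝒜 n) (⨆ n, ℬ n) P := by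
  have key : ∀ (ℱ : Filtration ℕ mΩ) (u : Ω → ℝ), Measurable[⨆ n, ℱ n] u →
      (∃ C, ∀ ω, |u ω| ≤ C) → ∃ (v : ℕ → Ω → ℝ) (C : ℝ), (∀ n, Measurable[ℱ n] (v n)) ∧
      (∀ n ω, |v n ω| ≤ C) ∧ (∀ᵐ ω ∂P, Tendsto (fun n => v n ω) atTop (𝓝 (u ω))) ∧
      MemLp u 2 P := by
    rintro ℱ u hu ⟨C, hC⟩
    have hle : ⨆ n, ℱ n ≤ mΩ := iSup_le fun n => ℱ.le n
    have huL : ∀ p, MemLp u p P := memLp_of_abs_le (hu.mono hle le_rfl) ⟨C, hC⟩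
    have hcond : ∀ n, ∀ᵐ ω ∂P, |(P[u | ℱ n]) ω| ≤ C := fun n =>
      ae_bdd_abs_condExp_of_ae_bdd_abs (ae_of_all _ hC)
    -- truncation at the bound `C` of `u` makes the conditional expectations bounded everywhere
    refine ⟨fun n ω => max (-C) (min C ((P[u | ℱ n]) ω)), |C|, fun n => ?_, fun n ω => ?_, ?_,
      huL 2⟩
    · exact measurable_const.max (measurable_const.min stronglyMeasurable_condExp.measurable)
    · have h0 : 0 ≤ C := (abs_nonneg _).trans (hC ω)
      rw [abs_of_nonneg h0]
      exact abs_le.2 ⟨le_max_left _ _, max_le (by linarith) (min_le_left _ _)⟩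
    · have hconv := ((huL 1).integrable le_rfl).tendsto_ae_condExp (ℱ := ℱ)
        (hu.stronglyMeasurable)
      filter_upwards [hconv, ae_all_iff.2 hcond] with ω h1 h2
      refine h1.congr fun n => ?_
      rw [min_eq_right (abs_le.1 (h2 n)).2, max_eq_right (abs_le.1 (h2 n)).1]
  intro f g hf hg hfb hgb
  obtain ⟨u, C, hu, huC, hul, hfL⟩ := key 𝒜 f hf hfb
  obtain ⟨v, D, hv, hvD, hvl, hgL⟩ := key ℬ g hg hgb
  exact abs_covariance_le_of_tendsto
    (fun n => ((hu n).mono (𝒜.le n) le_rfl).aestronglyMeasurable)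
    (fun n => ((hv n).mono (ℬ.le n) le_rfl).aestronglyMeasurable)
    (memLp_const C) (memLp_const D) (fun n => ae_of_all _ (huC n)) (fun n => ae_of_all _ (hvD n))
    hul hvl hfL hgL
    fun n => h n _ _ (hu n) (hv n) ⟨C, huC n⟩ ⟨D, hvD n⟩

/-! ### The Csáki–Fischer inequality -/

theorem IndepFun.integral_comp_prodMk {Ω 𝒵 𝒲 : Type*} {mΩ : MeasurableSpace Ω}
    {m𝒵 : MeasurableSpace 𝒵} {m𝒲 : MeasurableSpace 𝒲} {P : Measure Ω} [IsProbabilityMeasure P]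
    {Z : Ω → 𝒵} {W : Ω → 𝒲} (hZ : Measurable Z) (hW : Measurable W) (hind : IndepFun Z W P)
    {F : 𝒵 × 𝒲 → ℝ} (hF : Measurable F) (hFb : ∃ C, ∀ z, |F z| ≤ C) :
    ∫ ω, F (Z ω, W ω) ∂P = ∫ x, ∫ y, F (Z x, W y) ∂P ∂P := by
  have h1 : P.map (fun ω => (Z ω, W ω)) = (P.prod P).map (Prod.map Z W) := by
    rw [(indepFun_iff_map_prod_eq_prod_map_map hZ.aemeasurable hW.aemeasurable).1 hind,
      Measure.map_prod_map _ _ hZ hW]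
  rw [← integral_map (hZ.prodMk hW).aemeasurable hF.aestronglyMeasurable, h1,
    integral_map (hZ.prodMap hW).aemeasurable hF.aestronglyMeasurable, integral_prod]
  · rfl
  · obtain ⟨C, hC⟩ := hFb
    exact Integrable.of_bound (hF.comp (hZ.prodMap hW)).aestronglyMeasurable C
      (ae_of_all _ fun z => hC _)

/-- The law of total covariance for functions of two independent variables, the inner expectations
being taken over the second one. -/
theorem IndepFun.covariance_comp_prodMk {Ω 𝒵 𝒲 : Type*} {mΩ : MeasurableSpace Ω}
    {m𝒵 : MeasurableSpace 𝒵} {m𝒲 : MeasurableSpace 𝒲} {P : Measure Ω} [IsProbabilityMeasure P]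
    {Z : Ω → 𝒵} {W : Ω → 𝒲} (hZ : Measurable Z) (hW : Measurable W) (hind : IndepFun Z W P)
    {F G : 𝒵 × 𝒲 → ℝ} (hF : Measurable F) (hFb : ∃ C, ∀ z, |F z| ≤ C)
    (hG : Measurable G) (hGb : ∃ C, ∀ z, |G z| ≤ C) :
    Integrable (fun x => covariance (fun y => F (Z x, W y)) (fun y => G (Z x, W y)) P) P ∧
    covariance (fun ω => F (Z ω, W ω)) (fun ω => G (Z ω, W ω)) P =
      ∫ x, covariance (fun y => F (Z x, W y)) (fun y => G (Z x, W y)) P ∂P +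
      covariance (fun x => ∫ y, F (Z x, W y) ∂P) (fun x => ∫ y, G (Z x, W y) ∂P) P := by
  obtain ⟨C, hC⟩ := hFb
  obtain ⟨D, hD⟩ := hGb
  have bmul : ∀ z, |F z * G z| ≤ C * D := fun z => by
    rw [abs_mul]
    exact mul_le_mul (hC z) (hD z) (abs_nonneg _) ((abs_nonneg _).trans (hC z))
  have imeas : ∀ H : 𝒵 × 𝒲 → ℝ, Measurable H → Measurable fun x => ∫ y, H (Z x, W y) ∂P :=
    fun H hH => (StronglyMeasurable.integral_prod_right' (f := fun p : Ω × Ω => H (Z p.1, W p.2))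
      (by fun_prop : Measurable fun p : Ω × Ω => H (Z p.1, W p.2)).stronglyMeasurable).measurable
  have ibd : ∀ (H : 𝒵 × 𝒲 → ℝ) (B : ℝ), (∀ z, |H z| ≤ B) →
      ∀ x, |∫ y, H (Z x, W y) ∂P| ≤ B := fun H B hB x => by
    simpa using norm_integral_le_of_norm_le_const (μ := P) (f := fun y => H (Z x, W y)) (C := B)
      (ae_of_all _ fun y => hB _)
  have inner : ∀ x, covariance (fun y => F (Z x, W y)) (fun y => G (Z x, W y)) P =
      ∫ y, F (Z x, W y) * G (Z x, W y) ∂P - (∫ y, F (Z x, W y) ∂P) * ∫ y, G (Z x, W y) ∂P :=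
    fun x => covariance_eq_sub (memLp_of_abs_le (by fun_prop) ⟨C, fun _ => hC _⟩ 2)
      (memLp_of_abs_le (by fun_prop) ⟨D, fun _ => hD _⟩ 2)
  have i1 : Integrable (fun x => ∫ y, F (Z x, W y) * G (Z x, W y) ∂P) P :=
    Integrable.of_bound (imeas _ (hF.mul hG)).aestronglyMeasurable (C * D)
      (ae_of_all _ (ibd _ _ bmul))
  have m1 : MemLp (fun x => ∫ y, F (Z x, W y) ∂P) 2 P :=
    memLp_of_abs_le (imeas F hF) ⟨C, ibd F C hC⟩ 2
  have m2 : MemLp (fun x => ∫ y, G (Z x, W y) ∂P) 2 P :=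
    memLp_of_abs_le (imeas G hG) ⟨D, ibd G D hD⟩ 2
  have i2 : Integrable (fun x => (∫ y, F (Z x, W y) ∂P) * ∫ y, G (Z x, W y) ∂P) P :=
    m1.integrable_mul m2
  simp_rw [inner]
  refine ⟨i1.sub i2, ?_⟩
  rw [covariance_eq_sub m1 m2, covariance_eq_sub
    (memLp_of_abs_le (by fun_prop) ⟨C, fun _ => hC _⟩ 2)
    (memLp_of_abs_le (by fun_prop) ⟨D, fun _ => hD _⟩ 2), integral_sub i1 i2]
  simp only [Pi.mul_apply]
  rw [IndepFun.integral_comp_prodMk hZ hW hind hF ⟨C, hC⟩,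
    IndepFun.integral_comp_prodMk hZ hW hind hG ⟨D, hD⟩,
    IndepFun.integral_comp_prodMk hZ hW hind (F := fun z => F z * G z) (hF.mul hG) ⟨_, bmul⟩]
  ring

theorem integral_sqrt_mul_sqrt_le {Ω : Type*} {mΩ : MeasurableSpace Ω} {P : Measure Ω}
    {u v : Ω → ℝ} (hu : Integrable u P) (hv : Integrable v P) (hu0 : 0 ≤ u) (hv0 : 0 ≤ v) :
    Integrable (fun x => √(u x) * √(v x)) P ∧
    ∫ x, √(u x) * √(v x) ∂P ≤ √(∫ x, u x ∂P) * √(∫ x, v x ∂P) := by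
  have hm : ∀ w : Ω → ℝ, Integrable w P → 0 ≤ w → MemLp (fun x => √(w x)) 2 P := fun w hw h0 => by
    rw [memLp_two_iff_integrable_sq
      (Real.continuous_sqrt.comp_aestronglyMeasurable hw.aestronglyMeasurable)]
    exact hw.congr (ae_of_all _ fun x => (Real.sq_sqrt (h0 x)).symm)
  refine ⟨(hm u hu hu0).integrable_mul (hm v hv hv0), ?_⟩
  have h := integral_mul_le_Lp_mul_Lq_of_nonneg (μ := P) Real.HolderConjugate.two_two
    (ae_of_all _ fun x => Real.sqrt_nonneg (u x)) (ae_of_all _ fun x => Real.sqrt_nonneg (v x))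
    (by simpa using hm u hu hu0) (by simpa using hm v hv hv0)
  simp only [Real.rpow_two, Real.sq_sqrt (hu0 _), Real.sq_sqrt (hv0 _), ← Real.sqrt_eq_rpow] at h
  exact h

/-- The Csáki–Fischer inequality for variables: if `(U₁, V₁)` and `(U₂, V₂)` are independent, the
maximal correlation of `(U₁, U₂)` and `(V₁, V₂)` is at most the larger of those of `U₁, V₁` and of
`U₂, V₂`. Both terms of the law of total covariance are bounded separately, and the two bounds are
combined by the Cauchy–Schwarz inequality and the law of total variance. -/
theorem abs_covariance_prodMk_le {Ω 𝒰₁ 𝒱₁ 𝒰₂ 𝒱₂ : Type*} {mΩ : MeasurableSpace Ω}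
    {m₁ : MeasurableSpace 𝒰₁} {m₂ : MeasurableSpace 𝒱₁} {m₃ : MeasurableSpace 𝒰₂}
    {m₄ : MeasurableSpace 𝒱₂} {P : Measure Ω} [IsProbabilityMeasure P] {b : ℝ} (hb : 0 ≤ b)
    {U₁ : Ω → 𝒰₁} {V₁ : Ω → 𝒱₁} {U₂ : Ω → 𝒰₂} {V₂ : Ω → 𝒱₂}
    (hU₁ : Measurable U₁) (hV₁ : Measurable V₁) (hU₂ : Measurable U₂) (hV₂ : Measurable V₂)
    (hind : IndepFun (fun ω => (U₁ ω, V₁ ω)) (fun ω => (U₂ ω, V₂ ω)) P)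
    (h₁ : ∀ (f : 𝒰₁ → ℝ) (g : 𝒱₁ → ℝ), Measurable f → Measurable g →
      (∃ C, ∀ u, |f u| ≤ C) → (∃ C, ∀ v, |g v| ≤ C) →
      |covariance (fun ω => f (U₁ ω)) (fun ω => g (V₁ ω)) P| ≤
        b * (√(variance (fun ω => f (U₁ ω)) P) * √(variance (fun ω => g (V₁ ω)) P)))
    (h₂ : ∀ (f : 𝒰₂ → ℝ) (g : 𝒱₂ → ℝ), Measurable f → Measurable g →
      (∃ C, ∀ u, |f u| ≤ C) → (∃ C, ∀ v, |g v| ≤ C) →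
      |covariance (fun ω => f (U₂ ω)) (fun ω => g (V₂ ω)) P| ≤
        b * (√(variance (fun ω => f (U₂ ω)) P) * √(variance (fun ω => g (V₂ ω)) P)))
    {f : 𝒰₁ × 𝒰₂ → ℝ} {g : 𝒱₁ × 𝒱₂ → ℝ} (hf : Measurable f) (hg : Measurable g)
    (hfb : ∃ C, ∀ u, |f u| ≤ C) (hgb : ∃ C, ∀ v, |g v| ≤ C) :
    |covariance (fun ω => f (U₁ ω, U₂ ω)) (fun ω => g (V₁ ω, V₂ ω)) P| ≤
      b * (√(variance (fun ω => f (U₁ ω, U₂ ω)) P) *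
        √(variance (fun ω => g (V₁ ω, V₂ ω)) P)) := by
  obtain ⟨C, hC⟩ := hfb
  obtain ⟨D, hD⟩ := hgb
  set F : (𝒰₁ × 𝒱₁) × (𝒰₂ × 𝒱₂) → ℝ := fun z => f (z.1.1, z.2.1) with hFdef
  set G : (𝒰₁ × 𝒱₁) × (𝒰₂ × 𝒱₂) → ℝ := fun z => g (z.1.2, z.2.2) with hGdef
  have hF : Measurable F := by fun_prop
  have hG : Measurable G := by fun_prop
  have hFb : ∃ C, ∀ z, |F z| ≤ C := ⟨C, fun _ => hC _⟩
  have hGb : ∃ C, ∀ z, |G z| ≤ C := ⟨D, fun _ => hD _⟩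
  obtain ⟨ifg, efg⟩ := IndepFun.covariance_comp_prodMk (hU₁.prodMk hV₁) (hU₂.prodMk hV₂) hind
    hF hFb hG hGb
  obtain ⟨iff, eff⟩ := IndepFun.covariance_comp_prodMk (hU₁.prodMk hV₁) (hU₂.prodMk hV₂) hind
    hF hFb hF hFb
  obtain ⟨igg, egg⟩ := IndepFun.covariance_comp_prodMk (hU₁.prodMk hV₁) (hU₂.prodMk hV₂) hind
    hG hGb hG hGb
  have hmf : Measurable fun u => ∫ y, f (u, U₂ y) ∂P :=
    (StronglyMeasurable.integral_prod_right' (f := fun p : 𝒰₁ × Ω => f (p.1, U₂ p.2))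
      (by fun_prop : Measurable fun p : 𝒰₁ × Ω => f (p.1, U₂ p.2)).stronglyMeasurable).measurable
  have hmg : Measurable fun u => ∫ y, g (u, V₂ y) ∂P :=
    (StronglyMeasurable.integral_prod_right' (f := fun p : 𝒱₁ × Ω => g (p.1, V₂ p.2))
      (by fun_prop : Measurable fun p : 𝒱₁ × Ω => g (p.1, V₂ p.2)).stronglyMeasurable).measurable
  have hbf : ∀ u, |∫ y, f (u, U₂ y) ∂P| ≤ C := fun u => by
    simpa using norm_integral_le_of_norm_le_const (μ := P) (f := fun y => f (u, U₂ y)) (C := C)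
      (ae_of_all _ fun y => hC _)
  have hbg : ∀ u, |∫ y, g (u, V₂ y) ∂P| ≤ D := fun u => by
    simpa using norm_integral_le_of_norm_le_const (μ := P) (f := fun y => g (u, V₂ y)) (C := D)
      (ae_of_all _ fun y => hD _)
  have outer := h₁ _ _ hmf hmg ⟨C, hbf⟩ ⟨D, hbg⟩
  have inner : ∀ x, |covariance (fun y => f (U₁ x, U₂ y)) (fun y => g (V₁ x, V₂ y)) P| ≤
      b * (√(variance (fun y => f (U₁ x, U₂ y)) P) * √(variance (fun y => g (V₁ x, V₂ y)) P)) :=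
    fun x => h₂ (fun u => f (U₁ x, u)) (fun v => g (V₁ x, v)) (by fun_prop) (by fun_prop)
      ⟨C, fun _ => hC _⟩ ⟨D, fun _ => hD _⟩
  simp only [hFdef, hGdef] at ifg iff igg efg eff egg
  have am1 : ∀ x, AEMeasurable (fun y => f (U₁ x, U₂ y)) P := fun x =>
    Measurable.aemeasurable (by fun_prop)
  have am2 : ∀ x, AEMeasurable (fun y => g (V₁ x, V₂ y)) P := fun x =>
    Measurable.aemeasurable (by fun_prop)
  simp_rw [fun x => covariance_self (am1 x)] at iff eff
  simp_rw [fun x => covariance_self (am2 x)] at igg egg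
  rw [covariance_self (Measurable.aemeasurable (by fun_prop)),
    covariance_self (show AEMeasurable (fun x => ∫ y, f (U₁ x, U₂ y) ∂P) P from
      (hmf.comp hU₁).aemeasurable)] at eff
  rw [covariance_self (Measurable.aemeasurable (by fun_prop)),
    covariance_self (show AEMeasurable (fun x => ∫ y, g (V₁ x, V₂ y) ∂P) P from
      (hmg.comp hV₁).aemeasurable)] at egg
  obtain ⟨ics, hcs⟩ := integral_sqrt_mul_sqrt_le iff igg (fun x => variance_nonneg _ _)
    (fun x => variance_nonneg _ _)
  have hinner : |∫ x, covariance (fun y => f (U₁ x, U₂ y)) (fun y => g (V₁ x, V₂ y)) P ∂P| ≤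
      b * (√(∫ x, variance (fun y => f (U₁ x, U₂ y)) P ∂P) *
        √(∫ x, variance (fun y => g (V₁ x, V₂ y)) P ∂P)) := by
    refine (abs_integral_le_integral_abs).trans ?_
    refine (integral_mono ifg.abs (ics.const_mul b) inner).trans ?_
    rw [integral_const_mul]
    exact mul_le_mul_of_nonneg_left hcs hb
  rw [efg, eff, egg]
  refine (abs_add_le _ _).trans ((add_le_add hinner outer).trans ?_)
  rw [← mul_add]
  refine mul_le_mul_of_nonneg_left ?_ hb
  have n1 : 0 ≤ ∫ x, variance (fun y => f (U₁ x, U₂ y)) P ∂P :=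
    integral_nonneg fun x => variance_nonneg _ _
  have n2 : 0 ≤ ∫ x, variance (fun y => g (V₁ x, V₂ y)) P ∂P :=
    integral_nonneg fun x => variance_nonneg _ _
  have n3 := variance_nonneg (fun ω => ∫ y, f (U₁ ω, U₂ y) ∂P) P
  have n4 := variance_nonneg (fun ω => ∫ y, g (V₁ ω, V₂ y) ∂P) P
  rw [← Real.sqrt_mul (add_nonneg n1 n3)]
  refine Real.le_sqrt_of_sq_le ?_
  rw [add_sq, mul_pow, mul_pow, Real.sq_sqrt n1, Real.sq_sqrt n2, Real.sq_sqrt n3,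
    Real.sq_sqrt n4]
  -- the cross term is at most the arithmetic mean of the products of the variances
  have hsq := sq_nonneg (√(∫ x, variance (fun y => f (U₁ x, U₂ y)) P ∂P) *
      √(variance (fun ω => ∫ y, g (V₁ ω, V₂ y) ∂P) P) -
    √(∫ x, variance (fun y => g (V₁ x, V₂ y)) P ∂P) *
      √(variance (fun ω => ∫ y, f (U₁ ω, U₂ y) ∂P) P))
  rw [sub_sq, mul_pow, mul_pow, Real.sq_sqrt n1, Real.sq_sqrt n2, Real.sq_sqrt n3,
    Real.sq_sqrt n4] at hsq
  linarith

/-- The Csáki–Fischer inequality for two independent pairs of σ-fields. -/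
theorem CorrLe.sup {Ω : Type*} {b : ℝ} {𝒜₁ ℬ₁ 𝒜₂ ℬ₂ : MeasurableSpace Ω} {mΩ : MeasurableSpace Ω}
    {P : Measure Ω} [IsProbabilityMeasure P] (hb : 0 ≤ b)
    (hA₁ : 𝒜₁ ≤ mΩ) (hB₁ : ℬ₁ ≤ mΩ) (hA₂ : 𝒜₂ ≤ mΩ) (hB₂ : ℬ₂ ≤ mΩ)
    (hind : Indep (𝒜₁ ⊔ ℬ₁) (𝒜₂ ⊔ ℬ₂) P)
    (h₁ : CorrLe b 𝒜₁ ℬ₁ P) (h₂ : CorrLe b 𝒜₂ ℬ₂ P) : CorrLe b (𝒜₁ ⊔ 𝒜₂) (ℬ₁ ⊔ ℬ₂) P := by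
  have key : ∀ (m m' : MeasurableSpace Ω) (f : Ω → ℝ), Measurable[m ⊔ m'] f →
      (∃ C, ∀ ω, |f ω| ≤ C) →
      ∃ F : Ω × Ω → ℝ, Measurable[m.prod m'] F ∧ (∃ C, ∀ z, |F z| ≤ C) ∧
        ∀ ω, F (ω, ω) = f ω := by
    rintro m m' f hf ⟨C, hC⟩
    -- `m ⊔ m'` is the pull-back of the product σ-field along the diagonal map
    have hcomap : m ⊔ m' = MeasurableSpace.comap (fun ω => (ω, ω)) (m.prod m') := by
      have := @MeasurableSpace.comap_prodMk Ω Ω Ω m m' id id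
      simpa using this.symm
    rw [hcomap] at hf
    obtain ⟨F, hF', rfl⟩ := StronglyMeasurable.exists_eq_measurable_comp
      (mY := m.prod m') hf.stronglyMeasurable
    have hF := hF'.measurable
    refine ⟨fun z => max (-C) (min C (F z)), measurable_const.max (measurable_const.min hF),
      ⟨|C|, fun z => ?_⟩, fun ω => ?_⟩
    · have h0 : 0 ≤ C := (abs_nonneg _).trans (hC z.1)
      rw [abs_of_nonneg h0]
      exact abs_le.2 ⟨le_max_left _ _, max_le (by linarith) (min_le_left _ _)⟩
    · have := abs_le.1 (hC ω)
      simp only [Function.comp_apply] at this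
      simp only [Function.comp_apply]
      rw [min_eq_right this.2, max_eq_right this.1]
  intro f g hf hg hfb hgb
  obtain ⟨F, hF, hFb, hFf⟩ := key _ _ f hf hfb
  obtain ⟨G, hG, hGb, hGg⟩ := key _ _ g hg hgb
  obtain rfl : (fun ω => F (ω, ω)) = f := funext hFf
  obtain rfl : (fun ω => G (ω, ω)) = g := funext hGg
  -- the variables are the identity of `Ω`, with each of the four σ-fields on the target
  refine @abs_covariance_prodMk_le Ω Ω Ω Ω Ω mΩ 𝒜₁ ℬ₁ 𝒜₂ ℬ₂ P _ b hb id id id id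
    (measurable_id'' hA₁) (measurable_id'' hB₁) (measurable_id'' hA₂) (measurable_id'' hB₂)
    ?_ h₁ h₂ F G hF hG hFb hGb
  have e : ∀ m m' : MeasurableSpace Ω,
      MeasurableSpace.comap (fun ω : Ω => (id ω, id ω)) (m.prod m') = m ⊔ m' := fun m m' => by
    have := @MeasurableSpace.comap_prodMk Ω Ω Ω m m' id id
    simpa using this
  rw [← e, ← e] at hind
  exact (@IndepFun_iff_Indep Ω (Ω × Ω) (Ω × Ω) mΩ (𝒜₁.prod ℬ₁) (𝒜₂.prod ℬ₂) _ _ P).2 hind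

/-- The Csáki–Fischer inequality for a sequence of independent pairs of σ-fields. -/
theorem CorrLe.iSup_of_iIndep {Ω : Type*} {b : ℝ} {𝒜 ℬ : ℕ → MeasurableSpace Ω}
    {mΩ : MeasurableSpace Ω} {P : Measure Ω} [IsProbabilityMeasure P] (hb : 0 ≤ b)
    (hA : ∀ n, 𝒜 n ≤ mΩ) (hB : ∀ n, ℬ n ≤ mΩ) (hind : iIndep (fun n => 𝒜 n ⊔ ℬ n) P)
    (h : ∀ n, CorrLe b (𝒜 n) (ℬ n) P) : CorrLe b (⨆ n, 𝒜 n) (⨆ n, ℬ n) P := by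
  have fin : ∀ n : ℕ, CorrLe b (⨆ i ∈ Set.Iio n, 𝒜 i) (⨆ i ∈ Set.Iio n, ℬ i) P := by
    intro n
    induction n with
    | zero =>
      intro f g hf hg hfb hgb
      have h0 : (⨆ i ∈ Set.Iio 0, 𝒜 i) = ⊥ := by simp
      rw [h0] at hf
      obtain ⟨c, rfl⟩ := stronglyMeasurable_bot_iff.1 hf.stronglyMeasurable
      rw [covariance_const_left]
      simp only [abs_zero]
      positivity
    | succ n ih =>
      have e : ∀ m : ℕ → MeasurableSpace Ω,
          (⨆ i ∈ Set.Iio (n + 1), m i) = (⨆ i ∈ Set.Iio n, m i) ⊔ m n := fun m => by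
        have : Set.Iio (n + 1) = Set.Iio n ∪ {n} := by ext; simp [le_iff_lt_or_eq]
        rw [this, iSup_union, iSup_singleton]
      rw [e, e]
      refine CorrLe.sup hb (iSup₂_le fun i _ => hA i) (iSup₂_le fun i _ => hB i) (hA n) (hB n)
        ?_ ih (h n)
      have := indep_iSup_of_disjoint (fun i => sup_le (hA i) (hB i)) hind
        (S := Set.Iio n) (T := {n}) (by simp)
      rw [iSup_singleton] at this
      exact indep_of_indep_of_le_left this
        (sup_le (iSup₂_mono fun i _ => le_sup_left) (iSup₂_mono fun i _ => le_sup_right))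
  have lim : ∀ m : ℕ → MeasurableSpace Ω, (⨆ n, m n) ≤ ⨆ n : ℕ, ⨆ i ∈ Set.Iio n, m i :=
    fun m => iSup_le fun i => le_iSup_of_le (i + 1) (le_iSup₂_of_le i (Nat.lt_succ_self i) le_rfl)
  have mon : ∀ m : ℕ → MeasurableSpace Ω, Monotone fun n : ℕ => ⨆ i ∈ Set.Iio n, m i :=
    fun m i j hij => biSup_mono fun k (hk : k < i) => lt_of_lt_of_le hk hij
  exact (CorrLe.iSup_filtration
    ⟨fun n => ⨆ i ∈ Set.Iio n, 𝒜 i, mon 𝒜, fun n => iSup₂_le fun i _ => hA i⟩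
    ⟨fun n => ⨆ i ∈ Set.Iio n, ℬ i, mon ℬ, fun n => iSup₂_le fun i _ => hB i⟩ fin).mono
    (lim 𝒜) (lim ℬ)

/-! ### The parity law on finitely many binary digits -/

/-- The law of a fair coin. -/
noncomputable def coin : Measure (Fin 2) :=
  (2⁻¹ : ENNReal) • (Measure.dirac 0 + Measure.dirac 1)

instance : IsProbabilityMeasure coin :=
  ⟨by simp [coin, ← two_mul, ENNReal.mul_inv_cancel]⟩

theorem coin_map_rev : coin.map Fin.rev = coin := by
  rw [coin, Measure.map_smul, Measure.map_add _ _ (.of_discrete), Measure.map_dirac,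
    Measure.map_dirac, add_comm]
  rfl

/-- The sign attached to a binary digit. -/
def sgn (a : Fin 2) : ℝ := if a = 0 then 1 else -1

theorem sgn_rev (a : Fin 2) : sgn a.rev = -sgn a := by fin_cases a <;> simp [sgn]

theorem sgn_mul_self (a : Fin 2) : sgn a * sgn a = 1 := by fin_cases a <;> simp [sgn]

theorem DependsOn.update_of_notMem {ι α β : Type*} [DecidableEq ι] {h : (ι → α) → β}
    {A : Set ι} (hA : DependsOn h A) {e : ι} (he : e ∉ A) (s : ι → α) (a : α) :
    h (Function.update s e a) = h s :=
  hA fun _ hi => Function.update_of_ne (ne_of_mem_of_not_mem hi he) _ _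

section Parity

variable {ι : Type*} [Fintype ι]

/-- The law of independent fair coins indexed by a finite type. -/
noncomputable abbrev fairCoins (ι : Type*) [Fintype ι] : Measure (ι → Fin 2) :=
  Measure.pi fun _ => coin

open Classical in
/-- The product of the signs of the coordinates in `A`. -/
noncomputable def walsh (A : Set ι) (s : ι → Fin 2) : ℝ :=
  ∏ i with i ∈ A, sgn (s i)

/-- The law on `{0,1}^ι` with density `1 + c · (product of all signs)` with respect to independent
fair coins: any `|ι| - 1` coordinates are independent fair coins, but the product of all
signs has expectation `c`. -/
noncomputable def parityMeasure (ι : Type*) [Fintype ι] (c : ℝ) : Measure (ι → Fin 2) :=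
  (fairCoins ι).withDensity fun s => ENNReal.ofReal (1 + c * ∏ i, sgn (s i))

theorem abs_sgn (a : Fin 2) : |sgn a| = 1 := by fin_cases a <;> simp [sgn]

theorem walsh_mul_self (A : Set ι) (s : ι → Fin 2) :
    walsh A s * walsh A s = 1 := by
  simp [walsh, ← Finset.prod_mul_distrib, sgn_mul_self]

theorem integral_parityMeasure {c : ℝ} (hc : c ∈ Set.Icc (0 : ℝ) 1) (h : (ι → Fin 2) → ℝ) :
    ∫ s, h s ∂(parityMeasure ι c) =
      ∫ s, h s ∂(fairCoins ι) + c * ∫ s, (∏ i, sgn (s i)) * h s ∂(fairCoins ι) := by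
  have hpos : ∀ s : ι → Fin 2, 0 ≤ 1 + c * ∏ i, sgn (s i) := fun s => by
    have h1 : |∏ i, sgn (s i)| = 1 := by simp [Finset.abs_prod, abs_sgn]
    nlinarith [(abs_le.1 h1.le).1, hc.1, hc.2]
  rw [parityMeasure, integral_withDensity_eq_integral_toReal_smul (.of_discrete)
    (ae_of_all _ fun _ => ENNReal.ofReal_lt_top), ← integral_const_mul,
    ← integral_add .of_finite .of_finite]
  refine integral_congr_ae (ae_of_all _ fun s => ?_)
  simp only [ENNReal.toReal_ofReal (hpos s), smul_eq_mul]
  ring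

/-- Flipping one coordinate preserves the law of fair coins, so functions that are odd under such a
flip have integral zero. -/
theorem integral_eq_zero_of_flip [DecidableEq ι] {h : (ι → Fin 2) → ℝ} (e : ι)
    (hh : ∀ s, h (Function.update s e (s e).rev) = -h s) : ∫ s, h s ∂(fairCoins ι) = 0 := by
  have hmp : MeasurePreserving (fun (s : ι → Fin 2) i => (if i = e then Fin.rev else id) (s i))
      (fairCoins ι) (fairCoins ι) := by
    refine measurePreserving_pi _ _ fun i => ?_
    split_ifs
    · exact ⟨.of_discrete, coin_map_rev⟩
    · exact MeasurePreserving.id _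
  have h1 : ∫ s, h s ∂(fairCoins ι) =
      ∫ s : ι → Fin 2, h (fun i => (if i = e then Fin.rev else id) (s i)) ∂(fairCoins ι) := by
    conv_lhs => rw [← hmp.map_eq]
    exact integral_map hmp.measurable.aemeasurable
      (StronglyMeasurable.of_discrete).aestronglyMeasurable
  have h2 : ∀ s : ι → Fin 2, (fun i => (if i = e then Fin.rev else id) (s i)) =
      Function.update s e (s e).rev := fun s => by
    ext i
    by_cases hi : i = e
    · subst hi; simp
    · simp [hi]
  simp_rw [h2, hh] at h1
  rw [integral_neg] at h1
  linarith

open Classical in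
theorem walsh_update_of_mem {A : Set ι} {e : ι}
    (he : e ∈ A) (s : ι → Fin 2) :
    walsh A (Function.update s e (s e).rev) = -walsh A s := by
  have hmem : e ∈ Finset.univ.filter (· ∈ A) := by simpa using he
  rw [walsh, walsh, ← Finset.mul_prod_erase _ _ hmem, ← Finset.mul_prod_erase _ _ hmem]
  rw [Function.update_self, sgn_rev, neg_mul]
  congr 2
  refine Finset.prod_congr rfl fun i hi => ?_
  rw [Function.update_of_ne (Finset.ne_of_mem_erase hi)]

theorem dependsOn_walsh (A : Set ι) : DependsOn (walsh A) A := by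
  intro x y h
  exact Finset.prod_congr rfl fun i hi => by rw [h i (by simpa using hi)]

theorem integral_walsh_mul_of_notMem {A B : Set ι} {e : ι}
    (heB : e ∈ B) (heA : e ∉ A) {h : (ι → Fin 2) → ℝ} (hA : DependsOn h A) :
    ∫ s, walsh B s * h s ∂(fairCoins ι) = 0 := by
  classical
  exact integral_eq_zero_of_flip e fun s => by
    rw [walsh_update_of_mem heB, hA.update_of_notMem heA, neg_mul]

theorem walsh_univ (s : ι → Fin 2) : walsh Set.univ s = ∏ i, sgn (s i) := by
  simp [walsh]

theorem walsh_mul_walsh {A B : Set ι} (hAB : Disjoint A B) (s : ι → Fin 2) :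
    walsh (A ∪ B) s = walsh A s * walsh B s := by
  classical
  rw [walsh, walsh, walsh, ← Finset.prod_union]
  · congr 1
    ext i
    simp
  · exact Finset.disjoint_filter.2 fun i _ h1 h2 => Set.disjoint_left.1 hAB h1 h2

/-- A function that misses a coordinate has the same integral under `parityMeasure` and under
independent fair coins. -/
theorem integral_parityMeasure_of_notMem {c : ℝ} (hc : c ∈ Set.Icc (0 : ℝ) 1) {A : Set ι} {e : ι}
    (he : e ∉ A) {h : (ι → Fin 2) → ℝ} (hA : DependsOn h A) :
    ∫ s, h s ∂(parityMeasure ι c) = ∫ s, h s ∂(fairCoins ι) := by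
  rw [integral_parityMeasure hc]
  simp_rw [← walsh_univ]
  rw [integral_walsh_mul_of_notMem (Set.mem_univ e) he hA, mul_zero, add_zero]

theorem isFiniteMeasure_parityMeasure (c : ℝ) : IsFiniteMeasure (parityMeasure ι c) := by
  classical
  refine isFiniteMeasure_withDensity ?_
  rw [lintegral_fintype]
  exact (ENNReal.sum_lt_top.2 fun s _ => ENNReal.mul_lt_top ENNReal.ofReal_lt_top
    (measure_lt_top _ _)).ne

theorem isProbabilityMeasure_parityMeasure [Nonempty ι] {c : ℝ} (hc : c ∈ Set.Icc (0 : ℝ) 1) :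
    IsProbabilityMeasure (parityMeasure ι c) := by
  have := isFiniteMeasure_parityMeasure (ι := ι) c
  have h := integral_parityMeasure_of_notMem hc (Set.notMem_empty (Classical.arbitrary ι))
    (h := fun _ => 1) (fun _ _ _ => rfl)
  simp only [integral_const, probReal_univ, smul_eq_mul, mul_one] at h
  rw [measureReal_def, ENNReal.toReal_eq_one_iff] at h
  exact ⟨h⟩

theorem integral_mul_of_dependsOn {A B : Set ι} (hAB : Disjoint A B) {f g : (ι → Fin 2) → ℝ}
    (hf : DependsOn f A) (hg : DependsOn g B) :
    ∫ s, f s * g s ∂(fairCoins ι) = (∫ s, f s ∂(fairCoins ι)) * ∫ s, g s ∂(fairCoins ι) := by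
  classical
  have hind := (iIndepFun_pi (μ := fun _ : ι => coin) (X := fun _ => id)
    fun _ => aemeasurable_id).indepFun_finset A.toFinset B.toFinset
    (Set.disjoint_toFinset.2 hAB) (fun i => measurable_pi_apply i)
  obtain ⟨F, rfl⟩ := dependsOn_iff_exists_comp.1 hf
  obtain ⟨G, rfl⟩ := dependsOn_iff_exists_comp.1 hg
  exact (hind.comp (φ := fun r => F fun i => r ⟨i, by simp⟩)
    (ψ := fun r => G fun i => r ⟨i, by simp⟩)
    .of_discrete .of_discrete).integral_fun_mul_eq_mul_integral
    (StronglyMeasurable.of_discrete).aestronglyMeasurable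
    (StronglyMeasurable.of_discrete).aestronglyMeasurable

theorem memLp_of_finite {α : Type*} [Finite α] [MeasurableSpace α] [MeasurableSingletonClass α]
    {P : Measure α} [IsFiniteMeasure P] (f : α → ℝ) : MemLp f 2 P := by
  obtain ⟨C, hC⟩ := (Set.finite_range fun x => |f x|).bddAbove
  exact memLp_of_abs_le .of_discrete ⟨C, fun x => hC ⟨x, rfl⟩⟩ 2

theorem variance_parityMeasure_of_notMem {c : ℝ} (hc : c ∈ Set.Icc (0 : ℝ) 1) {A : Set ι} {e : ι}
    (he : e ∉ A) {h : (ι → Fin 2) → ℝ} (hA : DependsOn h A) :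
    variance h (parityMeasure ι c) = variance h (fairCoins ι) := by
  have : Nonempty ι := ⟨e⟩
  have := isProbabilityMeasure_parityMeasure (ι := ι) hc
  rw [variance_eq_sub (memLp_of_finite _), variance_eq_sub (memLp_of_finite _),
    integral_parityMeasure_of_notMem hc he hA,
    integral_parityMeasure_of_notMem hc he (h := h ^ 2)
      (fun x y hxy => by simp only [Pi.pow_apply, hA hxy])]

/-- The coefficient of `f` at a nonconstant normalized character is at most its standard
deviation. -/
theorem abs_integral_walsh_mul_le {A : Set ι} (hA : A.Nonempty)
    (f : (ι → Fin 2) → ℝ) :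
    |∫ s, walsh A s * f s ∂(fairCoins ι)| ≤ √(variance f (fairCoins ι)) := by
  obtain ⟨e, he⟩ := hA
  have h0 : ∫ s, walsh A s ∂(fairCoins ι) = 0 := by
    simpa using integral_walsh_mul_of_notMem he (Set.notMem_empty e) (h := fun _ => 1)
      (fun _ _ _ => rfl)
  have hv : variance (walsh A) (fairCoins ι) = 1 := by
    rw [variance_eq_sub (memLp_of_finite _), h0]
    simp [sq, walsh_mul_self]
  have hcov : covariance (walsh A) f (fairCoins ι) = ∫ s, walsh A s * f s ∂(fairCoins ι) := by
    rw [covariance_eq_sub (memLp_of_finite _) (memLp_of_finite _), h0]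
    simp
  have h1 := variance_nonneg (f - (∫ s, walsh A s * f s ∂(fairCoins ι)) • walsh A) (fairCoins ι)
  rw [variance_sub (memLp_of_finite _) (memLp_of_finite _), variance_smul, hv,
    covariance_smul_right, covariance_comm, hcov] at h1
  exact Real.abs_le_sqrt (by nlinarith)

/-- Two disjoint sets of coordinates have maximal correlation at most `c` under
`parityMeasure ι c`, and they are independent unless both are nonempty and together they exhaust
all coordinates. -/
theorem abs_covariance_parityMeasure_le [Nonempty ι] {c b : ℝ}
    (hc : c ∈ Set.Icc (0 : ℝ) 1) (hb : 0 ≤ b)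
    {A B : Set ι} (hAB : Disjoint A B)
    (hcb : A ∪ B = Set.univ → A.Nonempty → B.Nonempty → c ≤ b) {f g : (ι → Fin 2) → ℝ}
    (hf : DependsOn f A) (hg : DependsOn g B) :
    |covariance f g (parityMeasure ι c)| ≤
      b * (√(variance f (parityMeasure ι c)) * √(variance g (parityMeasure ι c))) := by
  classical
  have hconst : ∀ h : (ι → Fin 2) → ℝ, DependsOn h ∅ → ∃ r, h = fun _ => r :=
    fun h hh => ⟨h 0, funext fun s => hh.empty s 0⟩
  have := isProbabilityMeasure_parityMeasure (ι := ι) hc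
  rcases A.eq_empty_or_nonempty with rfl | hA
  · obtain ⟨r, rfl⟩ := hconst f hf
    rw [covariance_const_left, abs_zero]
    positivity
  rcases B.eq_empty_or_nonempty with rfl | hB
  · obtain ⟨r, rfl⟩ := hconst g hg
    rw [covariance_const_right, abs_zero]
    positivity
  obtain ⟨a, ha⟩ := hA
  obtain ⟨a', ha'⟩ := hB
  have haB : a ∉ B := fun h => Set.disjoint_left.1 hAB ha h
  have haA' : a' ∉ A := fun h => Set.disjoint_left.1 hAB h ha'
  -- the moments of `f` and `g` are those under fair coins; only the mixed moment may differ
  rw [variance_parityMeasure_of_notMem hc haA' hf, variance_parityMeasure_of_notMem hc haB hg,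
    covariance_eq_sub (memLp_of_finite _) (memLp_of_finite _),
    integral_parityMeasure_of_notMem hc haA' hf, integral_parityMeasure_of_notMem hc haB hg,
    integral_parityMeasure hc]
  simp only [Pi.mul_apply]
  rw [integral_mul_of_dependsOn hAB hf hg, add_sub_cancel_left]
  have hfg : DependsOn (fun s => f s * g s) (A ∪ B) := fun x y h => by
    simp only [hf fun i hi => h i (Or.inl hi), hg fun i hi => h i (Or.inr hi)]
  simp_rw [← walsh_univ]
  by_cases hU : A ∪ B = Set.univ
  · have hsplit : ∀ s : ι → Fin 2, walsh Set.univ s * (f s * g s) =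
        (walsh A s * f s) * (walsh B s * g s) := fun s => by
      rw [← hU, walsh_mul_walsh hAB]
      ring
    simp_rw [hsplit]
    rw [integral_mul_of_dependsOn hAB
      (f := fun s => walsh A s * f s) (g := fun s => walsh B s * g s)
      (fun x y h => by simp only [dependsOn_walsh A h, hf h])
      (fun x y h => by simp only [dependsOn_walsh B h, hg h]), abs_mul, abs_mul,
      abs_of_nonneg hc.1]
    exact mul_le_mul (hcb hU ⟨a, ha⟩ ⟨a', ha'⟩)
      (mul_le_mul (abs_integral_walsh_mul_le ⟨a, ha⟩ f) (abs_integral_walsh_mul_le ⟨a', ha'⟩ g)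
        (abs_nonneg _) (Real.sqrt_nonneg _)) (by positivity) hb
  · obtain ⟨e, he⟩ := (Set.ne_univ_iff_exists_notMem _).1 hU
    rw [integral_walsh_mul_of_notMem (Set.mem_univ e) he hfg, mul_zero, abs_zero]
    positivity

/-- The bound of `abs_covariance_parityMeasure_le` is attained by the sign products of the two
parts. -/
theorem corr_walsh {c : ℝ} (hc : c ∈ Set.Icc (0 : ℝ) 1)
    {A B : Set ι} (hAB : Disjoint A B) (hU : A ∪ B = Set.univ) (hA : A.Nonempty)
    (hB : B.Nonempty) : corr (walsh A) (walsh B) (parityMeasure ι c) = c := by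
  obtain ⟨a, ha⟩ := hA
  obtain ⟨a', ha'⟩ := hB
  have haB : a ∉ B := fun h => Set.disjoint_left.1 hAB ha h
  have haA' : a' ∉ A := fun h => Set.disjoint_left.1 hAB h ha'
  have : Nonempty ι := ⟨a⟩
  have := isProbabilityMeasure_parityMeasure (ι := ι) hc
  have hE : ∀ {C : Set ι} {e : ι}, e ∈ C → ∫ s, walsh C s ∂(fairCoins ι) = 0 := fun {C e} he => by
    simpa using integral_walsh_mul_of_notMem he (Set.notMem_empty e) (h := fun _ => 1)
      (fun _ _ _ => rfl)
  have hv : ∀ (C : Set ι) (e e' : ι), e ∈ C → e' ∉ C →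
      variance (walsh C) (parityMeasure ι c) = 1 := fun C e e' he he' => by
    rw [variance_parityMeasure_of_notMem hc he' (dependsOn_walsh C),
      variance_eq_sub (memLp_of_finite _), hE he]
    simp [sq, walsh_mul_self]
  rw [corr, hv A a a' ha haA', hv B a' a ha' haB,
    covariance_eq_sub (memLp_of_finite _) (memLp_of_finite _),
    integral_parityMeasure_of_notMem hc haA' (dependsOn_walsh A), hE ha]
  have : walsh A * walsh B = walsh (Set.univ : Set ι) := funext fun s => by
    rw [← hU, walsh_mul_walsh hAB, Pi.mul_apply]
  rw [this, integral_parityMeasure hc, hE (Set.mem_univ a)]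
  simp_rw [← walsh_univ, walsh_mul_self]
  simp

/-- A function that misses a coordinate has the same law under `parityMeasure` and under
independent fair coins. -/
theorem parityMeasure_map_of_dependsOn {c : ℝ} (hc : c ∈ Set.Icc (0 : ℝ) 1) {A : Set ι}
    (hA : A ≠ Set.univ) {κ : Type*} [Finite κ] [MeasurableSpace κ] [MeasurableSingletonClass κ]
    {φ : (ι → Fin 2) → κ} (hφ : DependsOn φ A) :
    (parityMeasure ι c).map φ = (fairCoins ι).map φ := by
  classical
  obtain ⟨e, he⟩ := (Set.ne_univ_iff_exists_notMem _).1 hA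
  have : Nonempty ι := ⟨e⟩
  have := isProbabilityMeasure_parityMeasure (ι := ι) hc
  ext t ht
  rw [Measure.map_apply .of_discrete ht, Measure.map_apply .of_discrete ht,
    ← ENNReal.toReal_eq_toReal_iff' (measure_ne_top _ _) (measure_ne_top _ _)]
  have h := integral_parityMeasure_of_notMem hc he
    (h := (φ ⁻¹' t).indicator fun _ => (1 : ℝ)) (fun x y hxy => by
      simp only [Set.indicator, Set.mem_preimage, hφ hxy])
  simp only [integral_indicator_const (1 : ℝ) (MeasurableSet.of_discrete (s := φ ⁻¹' t)),
    smul_eq_mul, mul_one] at h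
  exact h

/-- The coordinates in any proper subset are independent fair coins. -/
theorem iIndepFun_parityMeasure {c : ℝ} (hc : c ∈ Set.Icc (0 : ℝ) 1) {A : Set ι}
    (hA : A ≠ Set.univ) :
    iIndepFun (fun (i : A) (s : ι → Fin 2) => s i) (parityMeasure ι c) ∧
    ∀ i ∈ A, (parityMeasure ι c).map (fun s => s i) = coin := by
  classical
  obtain ⟨e, he⟩ := (Set.ne_univ_iff_exists_notMem _).1 hA
  have : Nonempty ι := ⟨e⟩
  have := isProbabilityMeasure_parityMeasure (ι := ι) hc
  have hm : ∀ i ∈ A, (parityMeasure ι c).map (fun s => s i) = (fairCoins ι).map (fun s => s i) :=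
    fun i hi => parityMeasure_map_of_dependsOn hc hA fun x y h => h i hi
  refine ⟨?_, fun i hi => ?_⟩
  · have h0 : iIndepFun (fun (i : A) (s : ι → Fin 2) => s i) (fairCoins ι) :=
      (iIndepFun_pi (μ := fun _ : ι => coin) (X := fun _ => id)
        fun _ => aemeasurable_id).precomp Subtype.val_injective
    rw [iIndepFun_iff_map_fun_eq_pi_map fun i => (measurable_pi_apply _).aemeasurable] at h0 ⊢
    rw [parityMeasure_map_of_dependsOn hc hA (φ := fun s (i : A) => s i)
      fun x y h => funext fun i => h i i.2, h0]
    congr 1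
    exact funext fun i => (hm i i.2).symm
  · rw [hm i hi]
    exact (measurePreserving_eval _ i).map_eq
end Parity

/-! ### Binary digits of a uniform random number -/

theorem coin_apply (t : Set (Fin 2)) :
    coin t = 2⁻¹ * (t.indicator 1 0 + t.indicator 1 1) := by
  simp [coin, mul_add]

theorem measurable_digits : Measurable fun x : ℝ => Real.digits x 2 := by
  refine measurable_pi_lambda _ fun i => ?_
  exact (Measurable.of_discrete (f := fun n : ℕ => Fin.ofNat 2 n)).comp
    (Nat.measurable_floor.comp (by fun_prop : Measurable fun x : ℝ => x * (2 : ℕ) ^ (i + 1)))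

theorem measurable_ofDigits : Measurable fun a : ℕ → Fin 2 => Real.ofDigits a :=
  Real.continuous_ofDigits.measurable

theorem digits_half_zero {y : ℝ} (hy : y ∈ Set.Ico (0 : ℝ) 1) : Real.digits (2⁻¹ * y) 2 0 = 0 := by
  have : 2⁻¹ * y * 2 = y := by ring
  simp [Real.digits, this, Nat.floor_eq_zero.2 hy.2]

theorem digits_half_succ (y : ℝ) (m : ℕ) :
    Real.digits (2⁻¹ * y) 2 (m + 1) = Real.digits y 2 m := by
  have : 2⁻¹ * y * ((2 : ℕ) : ℝ) ^ (m + 1 + 1) = y * ((2 : ℕ) : ℝ) ^ (m + 1) := by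
    push_cast; ring
  simp only [Real.digits, this]

theorem digits_half_add_zero {y : ℝ} (hy : y ∈ Set.Ico (0 : ℝ) 1) :
    Real.digits (2⁻¹ * (y + 1)) 2 0 = 1 := by
  have : 2⁻¹ * (y + 1) * 2 = y + 1 := by ring
  simp [Real.digits, this, Nat.floor_add_one hy.1, Nat.floor_eq_zero.2 hy.2]

theorem digits_half_add_succ {y : ℝ} (hy : 0 ≤ y) (m : ℕ) :
    Real.digits (2⁻¹ * (y + 1)) 2 (m + 1) = Real.digits y 2 m := by
  have : 2⁻¹ * (y + 1) * ((2 : ℕ) : ℝ) ^ (m + 1 + 1) =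
      y * ((2 : ℕ) : ℝ) ^ (m + 1) + ((2 ^ (m + 1) : ℕ) : ℝ) := by
    push_cast; ring
  simp only [Real.digits, this]
  rw [Nat.floor_add_natCast (by positivity)]
  ext
  simp [Fin.ofNat, Nat.add_mod, pow_succ]

/-- Lebesgue measure on `[0, 1)` is the average of its images under the affine maps of `[0, 1)`
onto its two halves; these maps prepend a binary digit. -/
theorem volume_inter_Ico_zero_one {s : Set ℝ} (hs : MeasurableSet s) :
    volume (s ∩ Set.Ico 0 1) = 2⁻¹ * (volume ((fun y => 2⁻¹ * y) ⁻¹' s ∩ Set.Ico 0 1) +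
      volume ((fun y => 2⁻¹ * (y + 1)) ⁻¹' s ∩ Set.Ico 0 1)) := by
  have hsplit : s ∩ Set.Ico (0 : ℝ) 1 = s ∩ Set.Ico 0 2⁻¹ ∪ s ∩ Set.Ico 2⁻¹ 1 := by
    rw [← Set.inter_union_distrib_left, Set.Ico_union_Ico_eq_Ico] <;> norm_num
  have h1 : volume ((fun y : ℝ => 2⁻¹ * y) ⁻¹' s ∩ Set.Ico 0 1) =
      2 * volume (s ∩ Set.Ico (0 : ℝ) 2⁻¹) := by
    have e : (fun y : ℝ => 2⁻¹ * y) ⁻¹' s ∩ Set.Ico 0 1 =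
        (fun y : ℝ => 2⁻¹ * y) ⁻¹' (s ∩ Set.Ico 0 2⁻¹) := by
      ext y
      simp
    rw [e, Real.volume_preimage_mul_left (by norm_num)]
    simp
  have h2 : volume ((fun y : ℝ => 2⁻¹ * (y + 1)) ⁻¹' s ∩ Set.Ico 0 1) =
      2 * volume (s ∩ Set.Ico (2⁻¹ : ℝ) 1) := by
    have e : (fun y : ℝ => 2⁻¹ * (y + 1)) ⁻¹' s ∩ Set.Ico 0 1 =
        (fun y : ℝ => y + 1) ⁻¹' ((fun y : ℝ => 2⁻¹ * y) ⁻¹' (s ∩ Set.Ico 2⁻¹ 1)) := by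
      ext y
      simp only [Set.mem_inter_iff, Set.mem_preimage, Set.mem_Ico]
      refine and_congr_right fun _ => ⟨fun h => ⟨?_, ?_⟩, fun h => ⟨?_, ?_⟩⟩ <;> linarith [h.1, h.2]
    rw [e, measure_preimage_add_right, Real.volume_preimage_mul_left (by norm_num)]
    simp
  rw [hsplit, measure_union _ (hs.inter measurableSet_Ico), h1, h2, ← mul_add, ← mul_assoc,
    ENNReal.inv_mul_cancel (by norm_num) (by norm_num), one_mul]
  exact Set.disjoint_left.2 fun x hx hx' => absurd hx.2.2 (not_lt.2 hx'.2.1)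

theorem volume_digits_mem (n : ℕ) (t : ℕ → Set (Fin 2)) :
    volume ({x | ∀ m < n, Real.digits x 2 m ∈ t m} ∩ Set.Ico 0 1) =
      ∏ m ∈ Finset.range n, coin (t m) := by
  induction n generalizing t with
  | zero => simp
  | succ n ih =>
    have hmeas : ∀ (n : ℕ) (t : ℕ → Set (Fin 2)),
        MeasurableSet {x | ∀ m < n, Real.digits x 2 m ∈ t m} := fun n t => by
      have : {x | ∀ m < n, Real.digits x 2 m ∈ t m} =
          (fun x : ℝ => Real.digits x 2) ⁻¹' (Set.pi (Set.Iio n) t) := by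
        ext; simp [Set.mem_pi]
      rw [this]
      exact measurable_digits (MeasurableSet.pi (Set.to_countable _) fun _ _ => .of_discrete)
    have half : ∀ (φ : ℝ → ℝ) (a : Fin 2),
        (∀ y ∈ Set.Ico (0 : ℝ) 1, Real.digits (φ y) 2 0 = a) →
        (∀ y ∈ Set.Ico (0 : ℝ) 1, ∀ m, Real.digits (φ y) 2 (m + 1) = Real.digits y 2 m) →
        volume (φ ⁻¹' {x | ∀ m < n + 1, Real.digits x 2 m ∈ t m} ∩ Set.Ico 0 1) =
          (t 0).indicator 1 a * ∏ m ∈ Finset.range n, coin (t (m + 1)) := by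
      intro φ a h0 hS
      rw [← ih]
      by_cases ha : a ∈ t 0
      · rw [Set.indicator_of_mem ha, Pi.one_apply, one_mul]
        congr 1
        ext y
        simp only [Set.mem_inter_iff, Set.mem_preimage, Set.mem_ofPred_eq]
        refine and_congr_left fun hy => ⟨fun h m hm => ?_, fun h m hm => ?_⟩
        · rw [← hS y hy]
          exact h _ (Nat.succ_lt_succ hm)
        · cases m with
          | zero => rwa [h0 y hy]
          | succ m =>
            rw [hS y hy]
            exact h m (Nat.lt_of_succ_lt_succ hm)
      · rw [Set.indicator_of_notMem ha, zero_mul]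
        convert measure_empty (μ := volume)
        ext y
        simp only [Set.mem_inter_iff, Set.mem_preimage, Set.mem_ofPred_eq, Set.mem_empty_iff_false,
          iff_false, not_and']
        intro hy h
        exact ha (h0 y hy ▸ h 0 n.succ_pos)
    rw [volume_inter_Ico_zero_one (hmeas _ t),
      half _ 0 (fun y hy => digits_half_zero hy) (fun y _ m => digits_half_succ y m),
      half _ 1 (fun y hy => digits_half_add_zero hy) (fun y hy m => digits_half_add_succ hy.1 m),
      Finset.prod_range_succ', coin_apply (t 0)]
    ring

/-- The binary digits of a uniform random number are independent fair coins. -/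
theorem map_digits_volume :
    (volume.restrict (Set.Ico (0 : ℝ) 1)).map (fun x => Real.digits x 2) =
      Measure.infinitePi fun _ : ℕ => coin := by
  classical
  refine Measure.eq_infinitePi _ fun s t ht => ?_
  obtain ⟨n, hn⟩ := s.exists_nat_subset_range
  have h := volume_digits_mem n fun m => if m ∈ s then t m else Set.univ
  rw [Measure.map_apply measurable_digits
    (MeasurableSet.pi (Set.to_countable _) fun i _ => ht i), Measure.restrict_apply
    (measurable_digits (MeasurableSet.pi (Set.to_countable _) fun i _ => ht i))]
  have e : (fun x : ℝ => Real.digits x 2) ⁻¹' (s : Set ℕ).pi t =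
      {x | ∀ m < n, Real.digits x 2 m ∈ if m ∈ s then t m else Set.univ} := by
    ext x
    simp only [Set.mem_preimage, Set.mem_pi, Finset.mem_coe, Set.mem_ofPred_eq]
    refine ⟨fun h m _ => ?_, fun h m hm => ?_⟩
    · split_ifs with hm
      · exact h m hm
      · trivial
    · simpa [hm] using h m (Finset.mem_range.1 (hn hm))
  rw [e, h, ← Finset.prod_subset hn]
  · exact Finset.prod_congr rfl fun m hm => by simp [hm]
  · intro m _ hm
    simp [hm]

/-- A binary expansion with independent fair digits is uniformly distributed. -/
theorem map_ofDigits_infinitePi :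
    (Measure.infinitePi fun _ : ℕ => coin).map (fun a => Real.ofDigits a) =
      volume.restrict (Set.Ico (0 : ℝ) 1) := by
  rw [← map_digits_volume, Measure.map_map measurable_ofDigits measurable_digits]
  conv_rhs => rw [← Measure.map_id (μ := volume.restrict (Set.Ico (0 : ℝ) 1))]
  refine Measure.map_congr ?_
  filter_upwards [ae_restrict_mem measurableSet_Ico] with x hx
  exact Real.ofDigits_digits one_lt_two hx

/-- Fair digits are almost surely recovered from the number they represent; the exceptions are the
sequences that are eventually one. -/
theorem ae_digits_ofDigits :
    ∀ᵐ a ∂(Measure.infinitePi fun _ : ℕ => coin), Real.digits (Real.ofDigits a) 2 = a := by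
  have hs : MeasurableSet {a : ℕ → Fin 2 | Real.digits (Real.ofDigits a) 2 = a} :=
    measurableSet_eq_fun (measurable_digits.comp measurable_ofDigits) measurable_id
  rw [← map_digits_volume, ae_map_iff measurable_digits.aemeasurable hs]
  filter_upwards [ae_restrict_mem measurableSet_Ico] with x hx
  rw [Real.ofDigits_digits one_lt_two hx]

/-! ### The random field of a family of templates -/

/-- Grouping an independent family with two indices by its first index. -/
theorem iIndepFun.curry {Ω α β 𝒳 : Type*} {mΩ : MeasurableSpace Ω} {m𝒳 : MeasurableSpace 𝒳}
    {P : Measure Ω} {X : α × β → Ω → 𝒳} (hX : ∀ q, Measurable (X q)) (h : iIndepFun X P) :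
    iIndepFun (fun a ω b => X (a, b) ω) P := by
  have := h.isProbabilityMeasure
  have : ∀ q, IsProbabilityMeasure (P.map (X q)) :=
    fun q => Measure.isProbabilityMeasure_map (hX q).aemeasurable
  rw [iIndepFun_iff_map_fun_eq_infinitePi_map (by fun_prop)]
  have h1 := (iIndepFun_iff_map_fun_eq_infinitePi_map hX).1 h
  have h2 := Measure.infinitePi_map_curry fun a b => P.map (X (a, b))
  rw [← h1, Measure.map_map (by fun_prop) (by fun_prop)] at h2
  refine Eq.trans h2 ?_
  congr 1
  funext a
  have h3 : iIndepFun (fun b => X (a, b)) P :=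
    h.precomp (g := fun b => (a, b)) (Prod.mk_right_injective a)
  exact ((iIndepFun_iff_map_fun_eq_infinitePi_map (fun b => hX (a, b))).1 h3).symm

theorem corr_congr_ae {Ω : Type*} {mΩ : MeasurableSpace Ω} {P : Measure Ω} {f f' g g' : Ω → ℝ}
    (hf : f =ᵐ[P] f') (hg : g =ᵐ[P] g') : corr f g P = corr f' g' P := by
  have : covariance f g P = covariance f' g' P := by
    rw [covariance, covariance, integral_congr_ae hf, integral_congr_ae hg]
    refine integral_congr_ae ?_
    filter_upwards [hf, hg] with ω h1 h2
    rw [h1, h2]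
  rw [corr, corr, this, variance_congr hf, variance_congr hg]

section Field

variable {V I : Type} (F : I → Finset V) (c : I → ℝ)

/-- For every template `i` and every translation vector `v`, a configuration of binary digits on
the translate `v + F i`, recorded on `F i` itself. -/
abbrev Config : Type := (j : I × V) → F j.1 → Fin 2

/-- All the translated templates are independent, and each of them follows the parity law. -/
noncomputable def templateMeasure [∀ i, IsProbabilityMeasure (parityMeasure (F i) (c i))] :
    Measure (Config F) :=
  Measure.infinitePi fun j : I × V => parityMeasure (F j.1) (c j.1)

instance [∀ i, IsProbabilityMeasure (parityMeasure (F i) (c i))] :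
    IsProbabilityMeasure (templateMeasure F c) := by
  rw [templateMeasure]; infer_instance

theorem templateMeasure_map_eval [∀ i, IsProbabilityMeasure (parityMeasure (F i) (c i))]
    (j : I × V) :
    (templateMeasure F c).map (fun ω => ω j) = parityMeasure (F j.1) (c j.1) :=
  Measure.infinitePi_map_eval _ j

theorem covariance_comp_eval [∀ i, IsProbabilityMeasure (parityMeasure (F i) (c i))]
    (j : I × V) (f g : (F j.1 → Fin 2) → ℝ) :
    covariance (fun ω => f (ω j)) (fun ω => g (ω j)) (templateMeasure F c) =
      covariance f g (parityMeasure (F j.1) (c j.1)) := by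
  rw [← templateMeasure_map_eval F c j]
  exact (covariance_map (StronglyMeasurable.of_discrete).aestronglyMeasurable
    (StronglyMeasurable.of_discrete).aestronglyMeasurable
    (measurable_pi_apply j).aemeasurable).symm

theorem variance_comp_eval [∀ i, IsProbabilityMeasure (parityMeasure (F i) (c i))]
    (j : I × V) (f : (F j.1 → Fin 2) → ℝ) :
    variance (fun ω => f (ω j)) (templateMeasure F c) =
      variance f (parityMeasure (F j.1) (c j.1)) := by
  rw [← templateMeasure_map_eval F c j]
  exact (variance_map Measurable.of_discrete.aemeasurable
    (measurable_pi_apply j).aemeasurable).symm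

variable [AddCommGroup V]

/-- The digit which the site `k` receives as the point `p.2` of a translate of the template
`p.1`. -/
def bit (k : V) (p : Σ i, F i) (ω : Config F) : Fin 2 :=
  ω (p.1, k - p.2) p.2

theorem measurable_bit (k : V) (p : Σ i, F i) : Measurable (bit F k p) :=
  (measurable_pi_apply p.2).comp (measurable_pi_apply (p.1, k - (p.2 : V)))

/-- The random variable at the site `k`: the number whose binary digits are all the digits
received by `k`. -/
noncomputable def field (e : ℕ ≃ Σ i, F i) (k : V) (ω : Config F) : ℝ :=
  Real.ofDigits fun m => bit F k (e m) ω

theorem measurable_field (e : ℕ ≃ Σ i, F i) (k : V) : Measurable (field F e k) :=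
  measurable_ofDigits.comp (measurable_pi_lambda _ fun m => measurable_bit F k (e m))

variable {F c} [∀ i, IsProbabilityMeasure (parityMeasure (F i) (c i))]

/-- Fewer sites than the size of any template see only independent fair digits, as no template has
all its points among these sites. -/
theorem iIndepFun_bit (hc : ∀ i, c i ∈ Set.Icc (0 : ℝ) 1) {α : Type} [Fintype α] {κ : α → V}
    (hκ : Function.Injective κ) (hF : ∀ i, Fintype.card α < (F i).card) :
    iIndepFun (fun q : α × Σ i, F i => bit F (κ q.1) q.2) (templateMeasure F c) ∧
    ∀ q : α × Σ i, F i, (templateMeasure F c).map (bit F (κ q.1) q.2) = coin := by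
  classical
  set A : (j : I × V) → Set (F j.1) := fun j => {w | j.2 + w ∈ Set.range κ}
  have hA : ∀ j, A j ≠ Set.univ := by
    intro j hj
    have hsub : ∀ w : F j.1, ∃ a, κ a = j.2 + w := fun w => by
      have : w ∈ A j := hj ▸ Set.mem_univ w
      exact this
    choose a ha using hsub
    have hinj : Function.Injective a := fun w w' h => by
      have := ha w
      rw [h, ha w'] at this
      exact Subtype.ext (add_left_cancel this).symm
    have := Fintype.card_le_of_injective a hinj
    rw [Fintype.card_coe] at this
    exact absurd this (not_le.2 (hF j.1))
  have hblock := fun j => iIndepFun_parityMeasure (hc j.1) (hA j)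
  have key : ∀ q : α × Σ i, F i, q.2.2 ∈ A (q.2.1, κ q.1 - q.2.2) := fun q =>
    ⟨q.1, by simp⟩
  refine ⟨?_, fun q => ?_⟩
  · have hall : iIndepFun (fun (p : Σ j : I × V, A j) (ω : Config F) => ω p.1 p.2)
        (templateMeasure F c) := by
      refine iIndepFun_uncurry (X := fun (j : I × V) (w : A j) (ω : Config F) => ω j w)
        (fun j w => by fun_prop) ?_ fun j => ?_
      · exact iIndepFun_infinitePi (P := fun j : I × V => parityMeasure (F j.1) (c j.1))
          (X := fun j s (w : A j) => s w) fun j => by fun_prop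
      · have h1 := (hblock j).1
        rw [iIndepFun_iff_map_fun_eq_infinitePi_map (by fun_prop)] at h1 ⊢
        rw [← templateMeasure_map_eval F c j, Measure.map_map (by fun_prop) (by fun_prop)] at h1
        refine Eq.trans h1 ?_
        congr 1
        funext w
        rw [Measure.map_map (by fun_prop) (by fun_prop)]
        rfl
    refine hall.precomp (g := fun q : α × Σ i, F i =>
      (⟨(q.2.1, κ q.1 - q.2.2), ⟨q.2.2, key q⟩⟩ : Σ j : I × V, A j)) ?_
    rintro ⟨a, i, w⟩ ⟨a', i', w'⟩ h
    simp only [Sigma.mk.injEq, Prod.mk.injEq] at h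
    obtain ⟨⟨rfl, h1⟩, h2⟩ := h
    have hw : w = w' := by
      have h3 : ∀ (x y : V) (hxy : x = y) (hx : w ∈ A (i, x)) (hy : w' ∈ A (i, y)),
          HEq (⟨w, hx⟩ : A (i, x)) (⟨w', hy⟩ : A (i, y)) → w = w' := by
        rintro x y rfl hx hy h
        exact congrArg Subtype.val (eq_of_heq h)
      exact h3 _ _ h1 _ _ h2
    subst hw
    rw [hκ (sub_left_injective h1)]
  · have h1 := (hblock (q.2.1, κ q.1 - q.2.2)).2 q.2.2 (key q)
    rw [← templateMeasure_map_eval F c, Measure.map_map (by fun_prop) (by fun_prop)] at h1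
    exact h1

theorem map_bit_infinitePi (hc : ∀ i, c i ∈ Set.Icc (0 : ℝ) 1) (hF : ∀ i, 1 < (F i).card)
    (e : ℕ ≃ Σ i, F i) (k : V) :
    (templateMeasure F c).map (fun ω m => bit F k (e m) ω) =
      Measure.infinitePi fun _ : ℕ => coin := by
  obtain ⟨h1, h2⟩ := iIndepFun_bit hc (α := Unit) (κ := fun _ => k)
    (Function.injective_of_subsingleton _) (by simpa using hF)
  have h3 : iIndepFun (fun m : ℕ => bit F k (e m)) (templateMeasure F c) :=
    h1.precomp (g := fun m => ((), e m)) ((Prod.mk_right_injective ()).comp e.injective)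
  rw [(iIndepFun_iff_map_fun_eq_infinitePi_map fun m => measurable_bit F k (e m)).1 h3]
  congr 1
  exact funext fun m => h2 ((), e m)

theorem map_field (hc : ∀ i, c i ∈ Set.Icc (0 : ℝ) 1) (hF : ∀ i, 1 < (F i).card)
    (e : ℕ ≃ Σ i, F i) (k : V) :
    (templateMeasure F c).map (field F e k) = volume.restrict (Set.Ico (0 : ℝ) 1) := by
  rw [← map_ofDigits_infinitePi, ← map_bit_infinitePi hc hF e k,
    Measure.map_map measurable_ofDigits (measurable_pi_lambda _ fun m => measurable_bit F k (e m))]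
  rfl

theorem ae_digits_field (hc : ∀ i, c i ∈ Set.Icc (0 : ℝ) 1) (hF : ∀ i, 1 < (F i).card)
    (e : ℕ ≃ Σ i, F i) (k : V) :
    ∀ᵐ ω ∂(templateMeasure F c), ∀ p, Real.digits (field F e k ω) 2 (e.symm p) = bit F k p ω := by
  have h := ae_digits_ofDigits
  rw [← map_bit_infinitePi hc hF e k] at h
  filter_upwards [ae_of_ae_map
    (measurable_pi_lambda _ fun m => measurable_bit F k (e m)).aemeasurable h] with ω hω p
  have := congrFun hω (e.symm p)
  simpa [field] using this

theorem iIndepFun_field (hc : ∀ i, c i ∈ Set.Icc (0 : ℝ) 1) {α : Type} [Fintype α] {κ : α → V}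
    (hκ : Function.Injective κ) (hF : ∀ i, Fintype.card α < (F i).card) (e : ℕ ≃ Σ i, F i) :
    iIndepFun (fun a => field F e (κ a)) (templateMeasure F c) := by
  have h := iIndepFun.curry (fun q => measurable_bit F (κ q.1) q.2) (iIndepFun_bit hc hκ hF).1
  exact h.comp (fun _ (b : (Σ i, F i) → Fin 2) => Real.ofDigits fun m => b (e m)) fun _ =>
    measurable_ofDigits.comp (by fun_prop)

/-- Translating the field amounts to permuting the independent templates. -/
theorem identDistrib_field_shift (e : ℕ ≃ Σ i, F i) (v : V) :
    IdentDistrib (fun ω k => field F e (k + v) ω) (fun ω k => field F e k ω)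
      (templateMeasure F c) (templateMeasure F c) := by
  have hm : Measurable fun ω k => field F e k ω :=
    measurable_pi_lambda _ fun k => measurable_field F e k
  refine ⟨(measurable_pi_lambda _ fun k => measurable_field F e (k + v)).aemeasurable,
    hm.aemeasurable, ?_⟩
  have hshift : (templateMeasure F c).map (fun ω (j : I × V) => ω (j.1, j.2 + v)) =
      templateMeasure F c :=
    Measure.map_infinitePi_infinitePi_of_inj
      (P := fun j : I × V => parityMeasure (F j.1) (c j.1)) (f := fun j : I × V => (j.1, j.2 + v))
      fun j j' h => by
        simp only [Prod.mk.injEq, add_left_inj] at h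
        exact Prod.ext h.1 h.2
  conv_rhs => rw [← hshift]
  rw [Measure.map_map hm (by fun_prop)]
  congr 1
  funext ω k
  simp only [field, bit, Function.comp_apply]
  congr 1
  funext m
  rw [add_sub_right_comm]

/-- The σ-field of the digits which one translated template gives to the sites in `S`. -/
abbrev blockField (S : Set V) (j : I × V) : MeasurableSpace (Config F) :=
  MeasurableSpace.comap (fun ω => {w : F j.1 | j.2 + w ∈ S}.domRestrict (ω j)) inferInstance

theorem blockField_le_comap (S : Set V) (j : I × V) :
    blockField (F := F) S j ≤ MeasurableSpace.comap (fun ω => ω j) inferInstance := by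
  have : (fun ω : Config F => {w : F j.1 | j.2 + w ∈ S}.domRestrict (ω j)) =
    {w : F j.1 | j.2 + w ∈ S}.domRestrict ∘ fun ω : Config F => ω j := rfl
  rw [blockField, this, ← MeasurableSpace.comap_comp]
  exact MeasurableSpace.comap_mono (measurable_iff_comap_le.1
    (measurable_pi_lambda _ fun w => measurable_pi_apply _))

theorem blockField_le (S : Set V) (j : I × V) :
    blockField (F := F) S j ≤ (inferInstance : MeasurableSpace (Config F)) :=
  (blockField_le_comap S j).trans (measurable_iff_comap_le.1 (measurable_pi_apply j))

theorem sigmaField_field_le_pi (e : ℕ ≃ Σ i, F i) (S : Set V) :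
    sigmaField (field F e) S ≤ (inferInstance : MeasurableSpace (Config F)) :=
  iSup₂_le fun k _ => measurable_iff_comap_le.1 (measurable_field F e k)

theorem sigmaField_field_le (e : ℕ ≃ Σ i, F i) (S : Set V) :
    sigmaField (field F e) S ≤ ⨆ j : I × V, blockField (F := F) S j := by
  refine iSup₂_le fun k hk => ?_
  rw [← measurable_iff_comap_le]
  refine @Measurable.comp _ _ _ (⨆ j : I × V, blockField (F := F) S j) _ _ _ _
    measurable_ofDigits (@measurable_pi_lambda _ _ _ (⨆ j : I × V, blockField (F := F) S j) _ _
      fun m => ?_)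
  set j : I × V := ((e m).1, k - (e m).2)
  refine Measurable.mono ?_ (le_iSup _ j) le_rfl
  exact (measurable_pi_apply
    (⟨(e m).2, by simpa [j] using hk⟩ : {w : F j.1 | j.2 + w ∈ S})).comp
    (comap_measurable (fun ω : Config F => {w : F j.1 | j.2 + w ∈ S}.domRestrict (ω j)))

/-- A translated template correlates `S` and `T` only if it is split between them. -/
theorem corrLe_blockField (hc : ∀ i, c i ∈ Set.Icc (0 : ℝ) 1) (hF : ∀ i, (F i).Nonempty)
    {S T : Set V} (hST : Disjoint S T) {b : ℝ} (hb : 0 ≤ b) (j : I × V)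
    (h : (∀ w ∈ F j.1, j.2 + w ∈ S ∪ T) → (∃ w ∈ F j.1, j.2 + w ∈ S) →
      (∃ w ∈ F j.1, j.2 + w ∈ T) → c j.1 ≤ b) :
    CorrLe b (blockField (F := F) S j) (blockField T j) (templateMeasure F c) := by
  have key : ∀ (U : Set V) (f : Config F → ℝ), Measurable[blockField U j] f →
      ∃ f' : (F j.1 → Fin 2) → ℝ, DependsOn f' {w : F j.1 | j.2 + w ∈ U} ∧
        f = fun ω => f' (ω j) := by
    intro U f hf
    obtain ⟨f', -, rfl⟩ := Measurable.exists_eq_measurable_comp hf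
    exact ⟨f' ∘ {w : F j.1 | j.2 + w ∈ U}.domRestrict,
      dependsOn_iff_exists_comp.2 ⟨f', rfl⟩, rfl⟩
  intro f g hf hg _ _
  obtain ⟨f', hf', rfl⟩ := key S f hf
  obtain ⟨g', hg', rfl⟩ := key T g hg
  have : Nonempty (F j.1) := (hF j.1).to_subtype
  have h1 := abs_covariance_parityMeasure_le (hc j.1) hb
    (A := {w : F j.1 | j.2 + w ∈ S}) (B := {w : F j.1 | j.2 + w ∈ T})
    (Set.disjoint_left.2 fun w hw hw' => Set.disjoint_left.1 hST hw hw')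
    (fun hU ⟨w, hw⟩ ⟨w', hw'⟩ => h (fun x hx => by
      have : (⟨x, hx⟩ : F j.1) ∈
          {w : F j.1 | j.2 + (w : V) ∈ S} ∪ {w : F j.1 | j.2 + (w : V) ∈ T} :=
        hU ▸ Set.mem_univ _
      exact this) ⟨w, w.2, hw⟩ ⟨w', w'.2, hw'⟩) hf' hg'
  rw [covariance_comp_eval F c j, variance_comp_eval F c j, variance_comp_eval F c j]
  exact h1

/-- The correlation of two disjoint sets of sites is bounded by the parameters of those translated
templates which are split between the two sets. -/
theorem fieldCorr_field_le [Countable I] [Infinite I] [Countable V]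
    (hc : ∀ i, c i ∈ Set.Icc (0 : ℝ) 1)
    (hF : ∀ i, (F i).Nonempty) (e : ℕ ≃ Σ i, F i) {S T : Set V} (hST : Disjoint S T) {b : ℝ}
    (hb : 0 ≤ b)
    (h : ∀ i v, (∀ w ∈ F i, v + w ∈ S ∪ T) → (∃ w ∈ F i, v + w ∈ S) → (∃ w ∈ F i, v + w ∈ T) →
      c i ≤ b) :
    fieldCorr (templateMeasure F c) (field F e) S T ≤ b := by
  obtain ⟨φ⟩ : Nonempty (ℕ ≃ I × V) := by
    have := (nonempty_denumerable (I × V)).some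
    exact ⟨(Denumerable.eqv (I × V)).symm⟩
  have hle : ∀ U : Set V, sigmaField (field F e) U ≤ ⨆ n, blockField (F := F) U (φ n) := fun U =>
    (sigmaField_field_le e U).trans_eq (φ.iSup_comp (g := fun j => blockField (F := F) U j)).symm
  refine CorrLe.maxCorr_le (CorrLe.mono (CorrLe.iSup_of_iIndep hb (fun n => blockField_le S (φ n))
    (fun n => blockField_le T (φ n)) ?_ fun n => corrLe_blockField hc hF hST hb (φ n)
      (h _ _)) (hle S) (hle T)) hb (sigmaField_field_le_pi e S) (sigmaField_field_le_pi e T)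
  have hind : iIndepFun (fun (j : I × V) (ω : Config F) => ω j) (templateMeasure F c) :=
    iIndepFun_infinitePi (P := fun j : I × V => parityMeasure (F j.1) (c j.1))
      (X := fun j s => s) fun j => measurable_id
  exact iIndep_of_iIndep_of_le (hind.precomp φ.injective).iIndep fun n =>
    sup_le (blockField_le_comap S (φ n)) (blockField_le_comap T (φ n))

/-- A translated template split between two disjoint sets of sites forces their correlation to be
at least its parameter: the signs of its two parts have this correlation. -/
theorem le_fieldCorr_field (hc : ∀ i, c i ∈ Set.Icc (0 : ℝ) 1) (hF : ∀ i, 1 < (F i).card)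
    (e : ℕ ≃ Σ i, F i) {S T : Set V} (hST : Disjoint S T) {i : I} {v : V}
    (hU : ∀ w ∈ F i, v + w ∈ S ∪ T) (hS : ∃ w ∈ F i, v + w ∈ S) (hT : ∃ w ∈ F i, v + w ∈ T) :
    c i ≤ fieldCorr (templateMeasure F c) (field F e) S T := by
  classical
  -- `f S` is computed from the digits of the field in `S`; it equals the sign product almost surely
  let A : Set V → Set (F i) := fun U => {w | v + w ∈ U}
  let f : Set V → Config F → ℝ := fun U ω =>
    ∏ w with w ∈ A U, sgn (Real.digits (field F e (v + w) ω) 2 (e.symm ⟨i, w⟩))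
  have hfm : ∀ U, Measurable[sigmaField (field F e) U] (f U) := fun U => by
    refine Finset.measurable_prod _ fun w hw => ?_
    have hw' : v + (w : V) ∈ U := by simpa [A] using hw
    have h1 : Measurable[sigmaField (field F e) U] (field F e (v + w)) :=
      measurable_iff_comap_le.2 (le_iSup₂_of_le (v + (w : V)) hw' le_rfl)
    exact (Measurable.of_discrete (f := sgn)).comp
      (((measurable_pi_apply _).comp measurable_digits).comp h1)
  have hfL : ∀ U, MemLp (f U) 2 (templateMeasure F c) := fun U =>
    memLp_of_abs_le ((hfm U).mono (sigmaField_field_le_pi e U) le_rfl)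
      ⟨1, fun ω => by simp [f, Finset.abs_prod, abs_sgn]⟩ 2
  have hfae : ∀ U, f U =ᵐ[templateMeasure F c] fun ω => walsh (A U) (ω (i, v)) := fun U => by
    have h1 : ∀ᵐ ω ∂(templateMeasure F c), ∀ w : F i,
        Real.digits (field F e (v + w) ω) 2 (e.symm ⟨i, w⟩) = ω (i, v) w := by
      rw [ae_all_iff]
      intro w
      filter_upwards [ae_digits_field hc hF e (v + w)] with ω hω
      rw [hω ⟨i, w⟩]
      exact congrArg (fun x => ω (i, x) w) (add_sub_cancel_right v (w : V))
    filter_upwards [h1] with ω hω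
    simp only [f, hω, walsh]
  have hcorr : corr (f S) (f T) (templateMeasure F c) = c i := by
    rw [corr_congr_ae (hfae S) (hfae T), ← corr_walsh (hc i) (A := A S) (B := A T)
      (Set.disjoint_left.2 fun w hw hw' => Set.disjoint_left.1 hST hw hw')
      (Set.eq_univ_of_forall fun w => hU w w.2)
      (hS.elim fun w hw => ⟨⟨w, hw.1⟩, hw.2⟩) (hT.elim fun w hw => ⟨⟨w, hw.1⟩, hw.2⟩),
      corr, corr, covariance_comp_eval F c (i, v), variance_comp_eval F c (i, v),
      variance_comp_eval F c (i, v)]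
  exact le_csSup (corrSet_bddAbove _ _ _)
    ⟨f S, f T, hfm S, hfm T, hfL S, hfL T, by rw [hcorr, abs_of_nonneg (hc i).1]⟩

end Field

/-! ### The coefficients of half-spaces, slices and arbitrary sets -/

theorem fieldCorr_le_one {Ω ι : Type*} {mΩ : MeasurableSpace Ω} (P : Measure Ω)
    [IsProbabilityMeasure P] (X : ι → Ω → ℝ) (S T : Set ι) : fieldCorr P X S T ≤ 1 := by
  refine csSup_le (corrSet_nonempty _ _ _) ?_
  rintro r ⟨f, g, -, -, hf, hg, rfl⟩
  exact abs_corr_le_one hf hg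

theorem le_abs_sub_of_le_intDist {G H : Set ℤ} {δ : ℝ} (h : δ ≤ intDist G H) {x y : ℤ}
    (hx : x ∈ G) (hy : y ∈ H) : δ ≤ |(x : ℝ) - y| :=
  h.trans (csInf_le ⟨0, by rintro r ⟨_, _, _, _, rfl⟩; exact abs_nonneg _⟩ ⟨x, hx, y, hy, rfl⟩)

/-- A finite sequence with steps shorter than the distance of `G` and `H` cannot visit both. -/
theorem not_mem_of_steps_lt {G H : Set ℤ} (hGH : Disjoint G H) {δ : ℝ} (hδ : δ ≤ intDist G H)
    {a : ℕ → ℤ} {L : ℕ} (hU : ∀ m ≤ L, a m ∈ G ∪ H)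
    (hstep : ∀ m < L, |(a m : ℝ) - a (m + 1)| < δ) {m m' : ℕ} (hm : m ≤ L) (hm' : m' ≤ L)
    (hG : a m ∈ G) : a m' ∉ H := by
  have stepG : ∀ i < L, (a i ∈ G ↔ a (i + 1) ∈ G) := fun i hi => by
    constructor
    · intro h
      refine (hU (i + 1) hi).resolve_right fun h' => ?_
      exact absurd (le_abs_sub_of_le_intDist hδ h h') (not_le.2 (hstep i hi))
    · intro h
      refine (hU i hi.le).resolve_right fun h' => ?_
      have := le_abs_sub_of_le_intDist hδ h h'
      rw [abs_sub_comm] at this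
      exact absurd this (not_le.2 (hstep i hi))
  have all : ∀ i ≤ L, (a i ∈ G ↔ a 0 ∈ G) := fun i => by
    induction i with
    | zero => simp
    | succ i ih => exact fun hi => (stepG i hi).symm.trans (ih (Nat.le_of_succ_le hi))
  exact Set.disjoint_left.1 hGH ((all m' hm').2 ((all m hm).1 hG))

theorem disjoint_Iic_Ici {n : ℕ} (hn : 1 ≤ n) (j : ℤ) :
    Disjoint (Set.Iic j) (Set.Ici (j + n)) := by
  refine Set.disjoint_left.2 fun x (h1 : x ≤ j) (h2 : j + n ≤ x) => ?_
  omega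

theorem le_intDist_Iic_Ici (n : ℕ) (j : ℤ) :
    (n : ℝ) ≤ intDist (Set.Iic j) (Set.Ici (j + n)) := by
  refine le_csInf ⟨_, j, Set.mem_Iic.2 le_rfl, j + n, Set.mem_Ici.2 le_rfl, rfl⟩ ?_
  rintro r ⟨x, hx : x ≤ j, y, hy : j + n ≤ y, rfl⟩
  rw [abs_sub_comm]
  refine le_trans ?_ (le_abs_self _)
  have : (n : ℤ) ≤ y - x := by omega
  exact_mod_cast this

theorem rhoPrime_le {Ω : Type*} {mΩ : MeasurableSpace Ω} {d : ℕ} (P : Measure Ω)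
    (X : (Fin d → ℤ) → Ω → ℝ) (hd : 0 < d) {n : ℕ} {b : ℝ}
    (h : ∀ (u : Fin d) (G H : Set ℤ), Disjoint G H → (n : ℝ) ≤ intDist G H →
      fieldCorr P X {k | k u ∈ G} {k | k u ∈ H} ≤ b) (hn : 1 ≤ n) : rhoPrime P X n ≤ b := by
  refine csSup_le ⟨_, ⟨0, hd⟩, Set.Iic 0, Set.Ici (0 + n), Set.nonempty_Iic, Set.nonempty_Ici,
    disjoint_Iic_Ici hn 0, le_intDist_Iic_Ici n 0, rfl⟩ ?_
  rintro r ⟨u, G, H, -, -, hGH, hδ, rfl⟩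
  exact h u G H hGH hδ

section Rho

variable {Ω : Type*} {mΩ : MeasurableSpace Ω} {d : ℕ} (P : Measure Ω) [IsProbabilityMeasure P]
  (X : (Fin d → ℤ) → Ω → ℝ)

theorem le_rho (n : ℕ) (j : ℤ) (u : Fin d) :
    fieldCorr P X {k | k u ≤ j} {k | j + n ≤ k u} ≤ rho P X n :=
  le_csSup ⟨1, by rintro r ⟨j, u, rfl⟩; exact fieldCorr_le_one _ _ _ _⟩ ⟨j, u, rfl⟩

theorem rho_le_rhoPrime (hd : 0 < d) {n : ℕ} (hn : 1 ≤ n) : rho P X n ≤ rhoPrime P X n := by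
  refine csSup_le ⟨_, 0, ⟨0, hd⟩, rfl⟩ ?_
  rintro r ⟨j, u, rfl⟩
  refine le_csSup ⟨1, by rintro r ⟨_, _, _, _, _, _, _, rfl⟩; exact fieldCorr_le_one _ _ _ _⟩
    ⟨u, Set.Iic j, Set.Ici (j + n), Set.nonempty_Iic, Set.nonempty_Ici, disjoint_Iic_Ici hn j,
      le_intDist_Iic_Ici n j, rfl⟩

theorem rhoStar_eq_one {n : ℕ} {S T : Set (Fin d → ℤ)} (hS : S.Nonempty) (hT : T.Nonempty)
    (hST : Disjoint S T) (hn : (n : ℝ) ≤ latticeDist S T) (h : 1 ≤ fieldCorr P X S T) :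
    rhoStar P X n = 1 := by
  have hbdd : ∀ r ∈ {r | ∃ S T : Set (Fin d → ℤ), S.Nonempty ∧ T.Nonempty ∧ Disjoint S T ∧
      (n : ℝ) ≤ latticeDist S T ∧ r = fieldCorr P X S T}, r ≤ 1 := by
    rintro r ⟨S, T, -, -, -, -, rfl⟩
    exact fieldCorr_le_one _ _ _ _
  exact le_antisymm (csSup_le ⟨_, S, T, hS, hT, hST, hn, rfl⟩ hbdd)
    (h.trans (le_csSup ⟨1, hbdd⟩ ⟨S, T, hS, hT, hST, hn, rfl⟩))

end Rho

/-! ### The templates -/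

/-- The lattice points on the diagonal of a cube of side `L`. -/
def diagonal (d L : ℕ) : Finset (Fin d → ℤ) :=
  (Finset.range (L + 1)).image fun (m : ℕ) _ => (m : ℤ)

/-- A vertex of the cube far from its diagonal. -/
def corner (d L : ℕ) (u : Fin d) : ℤ := if (u : ℕ) = 0 then 0 else L

/-- Points on the first coordinate axis with gaps of length `m`. -/
def axisPoints (d N m : ℕ) : Finset (Fin d → ℤ) :=
  (Finset.range (N + 1)).image fun (i : ℕ) u => if (u : ℕ) = 0 then (i : ℤ) * m else 0

/-- The templates: the diagonals of large cubes, each with a vertex added, and the sets of points on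
the first axis with gaps `2, 3, …`. -/
def template (d N : ℕ) : ℕ ⊕ ℕ → Finset (Fin d → ℤ)
  | .inl n => insert (corner d (N + 2 * n)) (diagonal d (N + 2 * n))
  | .inr n => axisPoints d N (n + 2)

/-- The parameters of the parity laws on the templates. -/
def templateParam (c : ℕ → ℝ) : ℕ ⊕ ℕ → ℝ
  | .inl _ => 1
  | .inr n => c (n + 2)

theorem mem_diagonal {d L : ℕ} {k : Fin d → ℤ} :
    k ∈ diagonal d L ↔ ∃ m ≤ L, (fun _ => (m : ℤ)) = k := by
  simp [diagonal]

theorem zero_mem_diagonal (d L : ℕ) : 0 ∈ diagonal d L :=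
  mem_diagonal.2 ⟨0, L.zero_le, rfl⟩

theorem mem_axisPoints {d N m : ℕ} {k : Fin d → ℤ} :
    k ∈ axisPoints d N m ↔
      ∃ i ≤ N, (fun u : Fin d => if (u : ℕ) = 0 then (i : ℤ) * m else 0) = k := by
  simp [axisPoints]

theorem lt_card_template {d : ℕ} (hd : 0 < d) (N : ℕ) (i : ℕ ⊕ ℕ) : N < (template d N i).card := by
  cases i with
  | inl n =>
    refine lt_of_lt_of_le ?_ (Finset.card_le_card (Finset.subset_insert _ _))
    rw [diagonal, Finset.card_image_of_injective, Finset.card_range]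
    · omega
    · intro m m' h
      simpa using congrFun h ⟨0, hd⟩
  | inr n =>
    rw [template, axisPoints, Finset.card_image_of_injective, Finset.card_range]
    · omega
    · intro m m' h
      have := congrFun h ⟨0, hd⟩
      simp only [if_true] at this
      exact_mod_cast mul_right_cancel₀ (by positivity) this

/-- A translated template can be split by two sets of slices at distance at least `n ≥ 2` only if
its parameter is at most `c n`. The projections of the templates with a diagonal are intervals, so
these cannot be split; the other templates have gaps of constant length. -/
theorem templateParam_le {d N n : ℕ} (hn : 2 ≤ n) {c : ℕ → ℝ}
    (hc : ∀ m n, 1 ≤ m → m ≤ n → c n ≤ c m) {u : Fin d} {G H : Set ℤ} (hGH : Disjoint G H)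
    (hδ : (n : ℝ) ≤ intDist G H) (i : ℕ ⊕ ℕ) (v : Fin d → ℤ)
    (hU : ∀ w ∈ template d N i, v u + w u ∈ G ∪ H) (hG : ∃ w ∈ template d N i, v u + w u ∈ G)
    (hH : ∃ w ∈ template d N i, v u + w u ∈ H) : templateParam c i ≤ c n := by
  obtain ⟨w, hw, hwG⟩ := hG
  obtain ⟨w', hw', hwH⟩ := hH
  have hn' : (2 : ℝ) ≤ n := by exact_mod_cast hn
  cases i with
  | inl l =>
    exfalso
    have coord : ∀ w ∈ template d N (.inl l), ∃ m ≤ N + 2 * l, w u = m := fun w hw => by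
      rcases Finset.mem_insert.1 hw with rfl | hw
      · by_cases hu : (u : ℕ) = 0
        · exact ⟨0, by simp, by simp [corner, hu]⟩
        · exact ⟨_, le_rfl, by simp [corner, hu]⟩
      · obtain ⟨m, hm, rfl⟩ := mem_diagonal.1 hw
        exact ⟨m, hm, rfl⟩
    obtain ⟨m, hm, e⟩ := coord w hw
    obtain ⟨m', hm', e'⟩ := coord w' hw'
    rw [e] at hwG
    rw [e'] at hwH
    refine not_mem_of_steps_lt hGH hδ (a := fun m => v u + m) (L := N + 2 * l) (fun m hm => ?_)
      (fun m _ => ?_) hm hm' hwG hwH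
    · exact hU (fun _ => (m : ℤ)) (Finset.mem_insert_of_mem (mem_diagonal.2 ⟨m, hm, rfl⟩))
    · push_cast
      rw [show (v u + m - (v u + (m + 1)) : ℝ) = -1 by ring]
      norm_num
      linarith
  | inr l =>
    by_contra hlt
    have hl : l + 2 < n := by
      by_contra h
      exact hlt (hc n (l + 2) (by omega) (not_lt.1 h))
    obtain ⟨m, hm, rfl⟩ := mem_axisPoints.1 hw
    obtain ⟨m', hm', rfl⟩ := mem_axisPoints.1 hw'
    refine not_mem_of_steps_lt hGH hδ
      (a := fun m => v u + if (u : ℕ) = 0 then (m : ℤ) * (l + 2 : ℕ) else 0) (L := N)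
      (fun m hm => ?_) (fun m _ => ?_) hm hm' hwG hwH
    · exact hU _ (mem_axisPoints.2 ⟨m, hm, rfl⟩)
    · have hl' : ((l : ℝ) + 2) < n := by exact_mod_cast hl
      split_ifs
      · push_cast
        rw [show (v u + m * (l + 2) - (v u + (m + 1) * (l + 2)) : ℝ) = -(l + 2) by ring, abs_neg,
          abs_of_nonneg (by positivity)]
        exact hl'
      · simp
        linarith

theorem le_latticeDist_diagonal_corner {d : ℕ} (hd : 2 ≤ d) {n L : ℕ} (hL : 2 * n ≤ L) :
    (n : ℝ) ≤ latticeDist (diagonal d L : Set (Fin d → ℤ)) {corner d L} := by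
  refine le_csInf ⟨_, fun _ => ((0 : ℕ) : ℤ), mem_diagonal.2 ⟨0, by simp, rfl⟩, _, rfl, rfl⟩ ?_
  rintro r ⟨s, hs, t, rfl, rfl⟩
  obtain ⟨m, hm, rfl⟩ := mem_diagonal.1 hs
  refine Real.le_sqrt_of_sq_le ?_
  have hterm : ∀ u : Fin d, ((((fun _ => (m : ℤ)) - corner d L : Fin d → ℤ) u : ℤ) : ℝ) ^ 2 ≤
      ∑ u : Fin d, ((((fun _ => (m : ℤ)) - corner d L : Fin d → ℤ) u : ℤ) : ℝ) ^ 2 := fun u =>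
    Finset.single_le_sum
      (f := fun u : Fin d => ((((fun _ => (m : ℤ)) - corner d L : Fin d → ℤ) u : ℤ) : ℝ) ^ 2)
      (fun _ _ => sq_nonneg _) (Finset.mem_univ u)
  -- the first coordinate separates the points with `m ≥ n`, the second one all others
  rcases le_total n m with h | h
  · refine le_trans ?_ (hterm ⟨0, by omega⟩)
    simp only [Pi.sub_apply, corner, if_true, sub_zero, Int.cast_natCast]
    gcongr
  · refine le_trans ?_ (hterm ⟨1, by omega⟩)
    have h1 : (n : ℝ) + m ≤ L := by exact_mod_cast (by omega : n + m ≤ L)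
    simp only [Pi.sub_apply, corner, one_ne_zero, if_false, Int.cast_sub, Int.cast_natCast]
    nlinarith [(Nat.cast_nonneg n : (0 : ℝ) ≤ n)]

theorem disjoint_diagonal_corner {d : ℕ} (hd : 2 ≤ d) {L : ℕ} (hL : 0 < L) :
    Disjoint (diagonal d L : Set (Fin d → ℤ)) {corner d L} := by
  rw [Set.disjoint_singleton_right]
  intro h
  obtain ⟨m, -, hm⟩ := mem_diagonal.1 h
  have h0 := congrFun hm ⟨0, by omega⟩
  have h1 := congrFun hm ⟨1, by omega⟩
  simp [corner] at h0 h1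
  omega

/-! ### The field with prescribed coefficients -/

theorem theorem1p5 (d N : ℕ) (hd : 2 ≤ d) (hN : 2 ≤ N) (c : ℕ → ℝ)
    (hc_mem : ∀ n, 1 ≤ n → c n ∈ Set.Icc (0 : ℝ) 1)
    (hc_anti : ∀ m n, 1 ≤ m → m ≤ n → c n ≤ c m) :
    ∃ (Ω : Type) (_ : MeasurableSpace Ω) (P : Measure Ω) (X : (Fin d → ℤ) → Ω → ℝ),
      IsProbabilityMeasure P ∧
      (∀ k, Measurable (X k)) ∧
      StrictlyStationary P X ∧
      pdf.IsUniform (X 0) (Set.Icc (0 : ℝ) 1) P ∧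
      TuplewiseIndep N P X ∧
      (∀ n : ℕ, 1 ≤ n → rhoStar P X n = 1) ∧
      rho P X 1 = 1 ∧ rhoPrime P X 1 = 1 ∧
      (∀ n : ℕ, 2 ≤ n → rho P X n = c n ∧ rhoPrime P X n = c n) := by
  have hd0 : 0 < d := by omega
  have hcard := lt_card_template hd0 N
  have hcard1 : ∀ i, 1 < (template d N i).card := fun i => (by omega : 1 < N).trans (hcard i)
  have hne : ∀ i, (template d N i).Nonempty := fun i =>
    Finset.card_pos.1 (by have := hcard i; omega)
  have hparam : ∀ i, templateParam c i ∈ Set.Icc (0 : ℝ) 1 := fun i => by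
    cases i with
    | inl n => exact ⟨zero_le_one, le_rfl⟩
    | inr n => exact hc_mem _ (by omega)
  have (i : ℕ ⊕ ℕ) : Nonempty (template d N i) := (hne i).to_subtype
  have (i : ℕ ⊕ ℕ) : IsProbabilityMeasure (parityMeasure (template d N i) (templateParam c i)) :=
    isProbabilityMeasure_parityMeasure (hparam i)
  obtain ⟨e⟩ : Nonempty (ℕ ≃ Σ i, template d N i) := by
    have := (nonempty_denumerable (Σ i, template d N i)).some
    exact ⟨(Denumerable.eqv (Σ i, template d N i)).symm⟩
  have lower := fun {S T : Set (Fin d → ℤ)} (hST : Disjoint S T) i (v : Fin d → ℤ) =>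
    le_fieldCorr_field hparam hcard1 e hST (i := i) (v := v)
  set P := templateMeasure (template d N) (templateParam c)
  set X := field (template d N) e
  have hhalf : ∀ (n : ℕ), 1 ≤ n → Disjoint {k : Fin d → ℤ | k ⟨0, hd0⟩ ≤ 0}
      {k | 0 + (n : ℤ) ≤ k ⟨0, hd0⟩} := fun n hn => by
    refine Set.disjoint_left.2 fun k (h1 : k ⟨0, hd0⟩ ≤ 0) (h2 : 0 + (n : ℤ) ≤ k ⟨0, hd0⟩) => ?_
    omega
  have hrho1 : 1 ≤ rho P X 1 := by
    refine (lower (hhalf 1 le_rfl) (.inl 0) 0 (fun w _ => ?_) ?_ ?_).trans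
      (le_rho P X 1 0 ⟨0, hd0⟩)
    · simp only [Set.mem_union, Set.mem_ofPred_eq]
      omega
    · exact ⟨0, Finset.mem_insert_of_mem (zero_mem_diagonal _ _), by simp⟩
    · exact ⟨fun _ => ((1 : ℕ) : ℤ),
        Finset.mem_insert_of_mem (mem_diagonal.2 ⟨1, by omega, rfl⟩), by simp⟩
  have hprime1 : rhoPrime P X 1 ≤ 1 :=
    rhoPrime_le P X hd0 (fun u G H _ _ => fieldCorr_le_one _ _ _ _) le_rfl
  have hle1 := rho_le_rhoPrime P X hd0 (le_refl 1)
  refine ⟨Config (template d N), inferInstance, P, X, inferInstance, measurable_field _ e,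
    identDistrib_field_shift e, ?_, fun κ hκ => iIndepFun_field hparam hκ (by simpa using hcard) e,
    fun n hn => ?_, le_antisymm (hle1.trans hprime1) hrho1, le_antisymm hprime1 (hrho1.trans hle1),
    fun n hn => ?_⟩
  · rw [pdf.IsUniform, map_field hparam hcard1 e 0, ProbabilityTheory.cond,
      Measure.restrict_congr_set Ico_ae_eq_Icc]
    simp
  · have hdisj := disjoint_diagonal_corner hd (L := N + 2 * n) (by omega)
    have hmem := zero_mem_diagonal d (N + 2 * n)
    refine rhoStar_eq_one P X ⟨0, hmem⟩ (Set.singleton_nonempty _) hdisj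
      (le_latticeDist_diagonal_corner hd (by omega)) ?_
    refine lower hdisj (.inl n) 0 (fun w hw => ?_)
      ⟨0, Finset.mem_insert_of_mem hmem, by simpa using hmem⟩
      ⟨corner d (N + 2 * n), Finset.mem_insert_self _ _, by simp⟩
    rw [zero_add]
    rcases Finset.mem_insert.1 hw with rfl | hw
    · exact Or.inr rfl
    · exact Or.inl hw
  · have hupper : rhoPrime P X n ≤ c n := by
      refine rhoPrime_le P X hd0 (fun u G H hGH hδ => ?_) (by omega)
      exact fieldCorr_field_le hparam hne e
        (Set.disjoint_left.2 fun k hk hk' => Set.disjoint_left.1 hGH hk hk')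
        (hc_mem n (by omega)).1 fun i v => templateParam_le hn hc_anti hGH hδ i v
    have hlower : c n ≤ rho P X n := by
      obtain ⟨l, rfl⟩ := Nat.exists_eq_add_of_le' hn
      refine (lower (hhalf (l + 2) (by omega)) (.inr l) 0 (fun w hw => ?_) ?_ ?_).trans
        (le_rho P X (l + 2) 0 ⟨0, hd0⟩)
      · obtain ⟨m, -, rfl⟩ := mem_axisPoints.1 hw
        rcases Nat.eq_zero_or_pos m with rfl | hm
        · left; simp
        · right
          simp only [Set.mem_ofPred_eq, zero_add, if_true]
          have : (1 : ℤ) ≤ m := by exact_mod_cast hm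
          exact le_mul_of_one_le_left (by positivity) this
      · exact ⟨_, mem_axisPoints.2 ⟨0, Nat.zero_le _, rfl⟩, by simp⟩
      · exact ⟨_, mem_axisPoints.2 ⟨1, by omega, rfl⟩, by simp⟩
    have hle := rho_le_rhoPrime P X hd0 (by omega : 1 ≤ n)
    exact ⟨le_antisymm (hle.trans hupper) hlower, le_antisymm hupper (hlower.trans hle)⟩
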